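/- **Theorem (the Sample mechanism of individualized DP-SGD satisfies $(\{\varepsilon_1,\dots,\varepsilon_P\},\delta)$-DP).** *Setting.* Let $\mathcal D$ be a set of data points, each belonging to exactly one of the privacy groups $\mathcal G_1,\dots,\mathcal G_P$. Let $\ell(\theta,x)$ be a real-valued loss, $\theta\in\mathbb R^d$, $x\in\mathcal D$ (where $\ell(\cdot,x)$ is not differentiable, $\nabla_\theta\ell(\theta,x)$ is read as $0$). Fix a probability law for the initial parameters $\theta_0$, a learning rate $\eta\in\mathbb R$, a constant $B>0$ (the expected mini-batch size), a clip norm $c>0$, a shared noise multiplier $\sigma=\sigma_{\rm sample}>0$, sampling rates $q_1,\dots,q_P\in(0,1]$ and a number of iterations $I\ge 0$. On a finite dataset $D\subseteq\mathcal D$, each iteration $t$ of the Sample mechanism draws a mini-batch $L_t\subseteq D$ that contains each $x\in D\cap\mathcal G_p$ independently with probability $q_p$ (all $p$), draws $z_t\sim\mathcal N(0,\mathbf I_d)$ independently, and sets $$\theta_{t+1}=\theta_t-\frac{\eta}{B}\Big(\sum_{x\in L_t}\frac{\nabla_\theta \ell(\theta_t,x)}{\max(1,\|\nabla_\theta \ell(\theta_t,x)\|_2/c)}+\sigma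 c\,z_t\Big).$$ The output $M(D)$ is $\theta_I$. *Privacy notions.* For a group $p$, call finite datasets $D,D'\subseteq\mathcal D$ $p$-neighbours if one of them is obtained from the other by adding one data point of $\mathcal G_p$. For probability laws $\mu\ll\nu$ and $\alpha>1$ let $\mathbb D_\alpha(\mu\,\|\,\nu)=\frac1{\alpha-1}\log\int(\frac{d\mu}{d\nu})^\alpha\,d\nu$, and $\mathbb D_\alpha(\mu\,\|\,\nu)=\infty$ if $\mu\not\ll\nu$. $M$ is $(\alpha,\bar\varepsilon)$-RDP for group $p$ if $\mathbb D_\alpha(M(D)\,\|\,M(D'))\le\bar\varepsilon$ for all $p$-neighbours $D,D'$. $M$ satisfies $(\{\varepsilon_1,\dots,\varepsilon_P\},\delta)$-DP if for every $p$, all $p$-neighbours $D,D'$ and all measurable $R\subseteq\mathbb R^d$, $\Pr[M(D)\in R]\le e^{\varepsilon_p}\Pr[M(D')\in R]+\delta$. *Per-step cost.* For $q\in(0,1]$, $\alpha>1$, call $\rho\in\mathbb R$ an admissible per-step cost for $(q,\sigma,\alpha)$ if at least one of the following holds. 1. $\rho$ is at least the order-$\alpha$ Rényi privacy loss of the Sampled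 Gaussian Mechanism with rate $q$, noise multiplier $\sigma$ and sensitivity $1$, that is, with $\mu_0=\mathcal N(0,\sigma^2)$ and $\mu=(1-q)\,\mathcal N(0,\sigma^2)+q\,\mathcal N(1,\sigma^2)$ on $\mathbb R$, $$\rho\ \ge\ \max\{\mathbb D_\alpha(\mu\,\|\,\mu_0),\ \mathbb D_\alpha(\mu_0\,\|\,\mu)\}.$$ 2. $\rho\ge 2q^2\alpha/\sigma^2$, and, with $\Lambda=\log\big(1+\frac1{q(\alpha-1)}\big)$, the parameters satisfy $$q\le\tfrac15,\qquad \sigma\ge4,\qquad \alpha\le\tfrac12\sigma^2\Lambda-2\log\sigma,\qquad \alpha\le\frac{\frac12\sigma^2\Lambda^2-\log5-2\log\sigma}{\Lambda+\log(q\alpha)+\frac1{2\sigma^2}}.$$ *Claim.* (a) For every group $p$, every $\alpha>1$ and every admissible per-step cost $\rho$ for $(q_p,\sigma,\alpha)$, $M$ is $(\alpha,I\rho)$-RDP for group $p$. (b) Let $0<\delta<1$ and $\varepsilon_1,\dots,\varepsilon_P\in\mathbb R$, and suppose that $\sigma$ and the rates $q_p$ are chosen so that no group exceeds its budget after $I$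 iterations: for every $p$ there are $\alpha>1$ and an admissible per-step cost $\rho$ for $(q_p,\sigma,\alpha)$ with $$I\rho+\log\frac{\alpha-1}{\alpha}-\frac{\log\delta+\log\alpha}{\alpha-1}\ \le\ \varepsilon_p .$$ Then $M$ satisfies $(\{\varepsilon_1,\dots,\varepsilon_P\},\delta)$-DP. -/

import Mathlib

open MeasureTheory ProbabilityTheory
open scoped ENNReal

noncomputable section

namespace IDPSGD

/-! ### Rényi divergence and individualized privacy notions -/

open Classical in
/-- The Rényi divergence `D_α(μ ‖ ν) = (α - 1)⁻¹ log ∫ (dμ/dν)^α dν` of order `α > 1`, with the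
value `⊤` when `μ` is not absolutely continuous with respect to `ν`. -/
def renyiDiv {Ω : Type*} [MeasurableSpace Ω] (α : ℝ) (μ ν : Measure Ω) : EReal :=
  if μ ≪ ν then (((α - 1)⁻¹ : ℝ) : EReal) * ENNReal.log (∫⁻ ω, (μ.rnDeriv ν ω) ^ α ∂ν) else ⊤

/-- `M` is `(α, ε)`-RDP for privacy group `p`: for all datasets `D`, `D'` that differ in exactly one
data point, which belongs to group `p` (`D' = D ∪ {x}`, in both directions), the Rényi divergence of
order `α` between the output laws is at most `ε`. -/
def IsGroupRDP {X Ω : Type*} [DecidableEq X] [MeasurableSpace Ω] {P : ℕ}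
    (M : Finset X → Measure Ω) (grp : X → Fin P) (p : Fin P) (α ε : ℝ) : Prop :=
  ∀ (D : Finset X) (x : X), x ∉ D → grp x = p →
    renyiDiv α (M (insert x D)) (M D) ≤ (ε : EReal) ∧
    renyiDiv α (M D) (M (insert x D)) ≤ (ε : EReal)

/-- `M` is `(ε, δ)`-DP for privacy group `p`: the usual `(ε, δ)` inequalities hold for all
datasets that differ in exactly one data point, which belongs to group `p`. -/
def IsGroupDP {X Ω : Type*} [DecidableEq X] [MeasurableSpace Ω] {P : ℕ}
    (M : Finset X → Measure Ω) (grp : X → Fin P) (p : Fin P) (ε δ : ℝ) : Prop :=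
  ∀ (D : Finset X) (x : X), x ∉ D → grp x = p → ∀ R : Set Ω, MeasurableSet R →
    M (insert x D) R ≤ ENNReal.ofReal (Real.exp ε) * M D R + ENNReal.ofReal δ ∧
    M D R ≤ ENNReal.ofReal (Real.exp ε) * M (insert x D) R + ENNReal.ofReal δ

/-- Individualized `({ε_1, …, ε_P}, δ)`-DP: every group `p` has its own `(ε_p, δ)` guarantee. -/
def IsIDP {X Ω : Type*} [DecidableEq X] [MeasurableSpace Ω] {P : ℕ}
    (M : Finset X → Measure Ω) (grp : X → Fin P) (ε : Fin P → ℝ) (δ : ℝ) : Prop :=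
  ∀ p : Fin P, IsGroupDP M grp p (ε p) δ

/-! ### The training algorithm with per-group Poisson sampling -/

/-- The vector `g` clipped to norm at most `c`. -/
def clip {d : ℕ} (c : ℝ) (g : EuclideanSpace ℝ (Fin d)) : EuclideanSpace ℝ (Fin d) :=
  (max 1 (‖g‖ / c))⁻¹ • g

/-- The sum over the mini-batch `L` of the clipped per-example gradients at parameters `θ`.
(`gradient` has the value `0` at points where the loss is not differentiable.) -/
def clippedGradSum {X : Type*} {d : ℕ} (loss : EuclideanSpace ℝ (Fin d) → X → ℝ) (c : ℝ)
    (L : Finset X) (θ : EuclideanSpace ℝ (Fin d)) : EuclideanSpace ℝ (Fin d) :=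
  ∑ x ∈ L, clip c (gradient (fun ϑ => loss ϑ x) θ)

/-- The probability that Poisson sampling, in which each `x ∈ D` is included independently with the
rate `q (grp x)` of its group, draws the mini-batch `L ⊆ D`. -/
def batchProb {X : Type*} [DecidableEq X] {P : ℕ} (grp : X → Fin P) (q : Fin P → ℝ)
    (D L : Finset X) : ℝ≥0∞ :=
  ENNReal.ofReal ((∏ x ∈ L, q (grp x)) * ∏ x ∈ D \ L, (1 - q (grp x)))

/-- The parameters after one iteration started at `θ`, with mini-batch `L` and standard Gaussian
noise `z`: `θ - η · B⁻¹ · (∑ clipped gradients + σ c z)`. -/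
def update {X : Type*} {d : ℕ} (loss : EuclideanSpace ℝ (Fin d) → X → ℝ) (η B c σ : ℝ)
    (L : Finset X) (θ z : EuclideanSpace ℝ (Fin d)) : EuclideanSpace ℝ (Fin d) :=
  θ - η • B⁻¹ • (clippedGradSum loss c L θ + (σ * c) • z)

/-- The law of the parameters after one iteration started at `θ`. -/
def stepLaw {X : Type*} [DecidableEq X] {P d : ℕ} (grp : X → Fin P)
    (loss : EuclideanSpace ℝ (Fin d) → X → ℝ) (η B c σ : ℝ) (q : Fin P → ℝ)
    (D : Finset X) (θ : EuclideanSpace ℝ (Fin d)) : Measure (EuclideanSpace ℝ (Fin d)) :=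
  ∑ L ∈ D.powerset, batchProb grp q D L •
    (stdGaussian (EuclideanSpace ℝ (Fin d))).map (update loss η B c σ L θ)

/-- The mechanism: the law of the parameters `θ_t` after `t` iterations on the dataset `D`, when
`θ_0` is drawn from `init`. -/
def sampleMechanism {X : Type*} [DecidableEq X] {P d : ℕ} (grp : X → Fin P)
    (loss : EuclideanSpace ℝ (Fin d) → X → ℝ) (init : Measure (EuclideanSpace ℝ (Fin d)))
    (η B c σ : ℝ) (q : Fin P → ℝ) : ℕ → Finset X → Measure (EuclideanSpace ℝ (Fin d))
  | 0, _ => init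
  | t + 1, D =>
      (sampleMechanism grp loss init η B c σ q t D).bind (stepLaw grp loss η B c σ q D)

/-! ### Privacy accounting of the Sampled Gaussian Mechanism -/

/-- The mixture `(1 - q) N(0, σ²) + q N(1, σ²)` on the real line. -/
def sgmMixture (q σ : ℝ) : Measure ℝ :=
  ENNReal.ofReal (1 - q) • gaussianReal 0 (σ ^ 2).toNNReal +
    ENNReal.ofReal q • gaussianReal 1 (σ ^ 2).toNNReal

/-- The order-`α` Rényi privacy loss of one step of the Sampled Gaussian Mechanism with sampling
rate `q`, noise multiplier `σ` and sensitivity `1`: the larger of the two Rényi divergences between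
`(1 - q) N(0, σ²) + q N(1, σ²)` and `N(0, σ²)`. -/
def sgmRenyi (q σ α : ℝ) : EReal :=
  max (renyiDiv α (sgmMixture q σ) (gaussianReal 0 (σ ^ 2).toNNReal))
    (renyiDiv α (gaussianReal 0 (σ ^ 2).toNNReal) (sgmMixture q σ))

/-- The parameter regime of the closed-form bound `2 q² α / σ²` for the Sampled Gaussian
Mechanism, with `L = log (1 + 1 / (q (α - 1)))`. -/
def ClosedFormRegime (q σ α : ℝ) : Prop :=
  q ≤ 1 / 5 ∧ 4 ≤ σ ∧ 1 < α ∧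
    α ≤ σ ^ 2 * Real.log (1 + 1 / (q * (α - 1))) / 2 - 2 * Real.log σ ∧
    α ≤ (σ ^ 2 * Real.log (1 + 1 / (q * (α - 1))) ^ 2 / 2 - Real.log 5 - 2 * Real.log σ) /
      (Real.log (1 + 1 / (q * (α - 1))) + Real.log (q * α) + 1 / (2 * σ ^ 2))

/-- `ρ` is an admissible per-step privacy cost at order `α`: either it is at least the Rényi privacy
loss of the Sampled Gaussian Mechanism, or `(q, σ, α)` lies in the closed-form regime and `ρ` is at
least `2 q² α / σ²`. -/
def IsStepCost (q σ α ρ : ℝ) : Prop :=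
  sgmRenyi q σ α ≤ (ρ : EReal) ∨ (ClosedFormRegime q σ α ∧ 2 * q ^ 2 * α / σ ^ 2 ≤ ρ)

/-- The `ε` of the `(ε, δ)`-DP guarantee converted from an `(α, ρ)`-RDP guarantee. -/
def rdpToDP (α ρ δ : ℝ) : ℝ :=
  ρ + Real.log ((α - 1) / α) - (Real.log δ + Real.log α) / (α - 1)

/-! ### Measurability of the one-step law (so that the composition `bind` is the intended one) -/

lemma measurable_clip {d : ℕ} (c : ℝ) : Measurable (clip (d := d) c) := by
  unfold clip
  fun_prop

lemma measurable_clippedGradSum {X : Type*} {d : ℕ} (loss : EuclideanSpace ℝ (Fin d) → X → ℝ)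
    (c : ℝ) (L : Finset X) : Measurable (clippedGradSum loss c L) := by
  unfold clippedGradSum
  refine Finset.measurable_fun_sum _ fun x _ => (measurable_clip c).comp ?_
  unfold gradient
  exact (InnerProductSpace.toDual ℝ (EuclideanSpace ℝ (Fin d))).symm.continuous.measurable.comp
    (measurable_fderiv ℝ _)

lemma measurable_update {X : Type*} {d : ℕ} (loss : EuclideanSpace ℝ (Fin d) → X → ℝ)
    (η B c σ : ℝ) (L : Finset X) :
    Measurable (Function.uncurry (update loss η B c σ L)) := by
  have h := measurable_clippedGradSum loss c L
  unfold update Function.uncurry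
  fun_prop

lemma measurable_stepLaw {X : Type*} [DecidableEq X] {P d : ℕ} (grp : X → Fin P)
    (loss : EuclideanSpace ℝ (Fin d) → X → ℝ) (η B c σ : ℝ) (q : Fin P → ℝ) (D : Finset X) :
    Measurable (stepLaw grp loss η B c σ q D) := by
  refine Measure.measurable_of_measurable_coe _ fun s hs => ?_
  simp only [stepLaw, Measure.finsetSum_apply, Measure.smul_apply, smul_eq_mul]
  refine Finset.measurable_fun_sum _ fun L _ => Measurable.const_mul ?_ _
  have h := measurable_update loss η B c σ L
  have h' : ∀ θ, Measurable (update loss η B c σ L θ) := fun θ => h.of_uncurry_left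
  simp only [Measure.map_apply (h' _) hs]
  exact measurable_measure_prodMk_left (h hs)

end IDPSGD

end

/-!
Write `S = (1 - q) N(0, σ²) + q N(1, σ²)` and `T = N(0, σ²)` on the real line.

*One iteration.* Let `x` be the point by which `D` and `D ∪ {x}` differ, and let `v` be its clipped
gradient at the current parameters divided by the clip norm, so that `‖v‖ ≤ 1`. A scalar `y` can be
turned into the vector `y v + σ (1 - v vᵀ)^{1/2} z`, with `z` standard Gaussian, and this vector is
distributed as `a v + σ z` if `y ∼ N(a, σ²)` (`map_liftNoise`). Hence one iteration on `D ∪ {x}`,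
and one on `D`, are images of `S`, and of `T`, under the same Markov kernel `liftKernel`, which
draws the rest of the mini-batch. This replaces at once the rotation to one dimension, the monotonicity
in the sensitivity and the quasi-convexity over mini-batches.

*Composition.* For `μ ≪ ν` the moment `∫ (dμ/dν)^α dν` is multiplicative over products
(`renyiMoment_prod`) and does not increase under Markov kernels (`renyiMoment_bind_le`). An
iteration is the image of the product of the current law with `S` or `T`, so it multiplies the moment by at
most that of the pair `(S, T)`: `renyiDiv_sampleMechanism_le`.

*Closed form.* The ratio `dS/dT = 1 + u` has `∫ u dT = 0` and `∫ u² dT = q² (e^{1/σ²} - 1)`. As long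
as `(α - 1) u ≤ 1`, one has `(1 + u)^α ≤ 1 + α u + α (α - 1) u²`; beyond that point an exponential
bound holds, whose Gaussian integral is negligible in the given regime (`renyiMoment_sgmMixture_le`,
`ClosedFormRegime.excess_le`). The divergence of `T` from `S` is the smaller of the two, by the
reflection `z ↦ 1 - z` and the convexity of `x^α - x^(1-α)` on `[1, ∞)`
(`renyiMoment_gaussianReal_sgmMixture_le`).

*Conversion.* With `f = dμ/dν`, the inequality `f ≤ e^ε + C f^α`, where `C` is the best constant,
integrates over an event to the `(ε, δ)` inequality (`measure_le_of_renyiMoment_le`).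
-/

open MeasureTheory ProbabilityTheory
open scoped ENNReal

noncomputable section

namespace IDPSGD

/-! ### Moments of the likelihood ratio -/

/-- The moment `∫ (dμ/dν)^α dν` of the likelihood ratio, so that for `μ ≪ ν` the Rényi divergence
is `(α - 1)⁻¹ log` of it. Unlike the divergence it is multiplicative over products. -/
def renyiMoment {Ω : Type*} [MeasurableSpace Ω] (α : ℝ) (μ ν : Measure Ω) : ℝ≥0∞ :=
  ∫⁻ ω, (μ.rnDeriv ν ω) ^ α ∂ν

lemma renyiDiv_le_iff {Ω : Type*} [MeasurableSpace Ω] {α ρ : ℝ} (hα : 1 < α) {μ ν : Measure Ω} :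
    renyiDiv α μ ν ≤ (ρ : EReal) ↔
      μ ≪ ν ∧ renyiMoment α μ ν ≤ ENNReal.ofReal (Real.exp ((α - 1) * ρ)) := by
  have h0 : 0 < α - 1 := by linarith
  unfold renyiDiv renyiMoment
  split_ifs with h
  · rw [← ENNReal.log_le_log_iff (y := ENNReal.ofReal _),
      ENNReal.log_ofReal_of_pos (Real.exp_pos _), Real.log_exp]
    simp only [h, true_and]
    generalize ENNReal.log _ = y
    induction y with
    | bot => simp [EReal.coe_mul_bot_of_pos (inv_pos.2 h0)]
    | top =>
      simp only [EReal.coe_mul_top_of_pos (inv_pos.2 h0), top_le_iff]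
      exact ⟨fun h => absurd h (EReal.coe_ne_top _), fun h => absurd h (EReal.coe_ne_top _)⟩
    | coe y =>
      rw [← EReal.coe_mul, EReal.coe_le_coe_iff, EReal.coe_le_coe_iff, inv_mul_le_iff₀ h0]
  · simp [h]

lemma renyiMoment_withDensity {Ω : Type*} [MeasurableSpace Ω] (α : ℝ) {ν : Measure Ω}
    [SigmaFinite ν] {f : Ω → ℝ≥0∞} (hf : Measurable f) :
    renyiMoment α (ν.withDensity f) ν = ∫⁻ ω, f ω ^ α ∂ν := by
  refine lintegral_congr_ae ?_
  filter_upwards [ν.rnDeriv_withDensity hf] with ω hω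
  rw [hω]

lemma renyiMoment_self {Ω : Type*} [MeasurableSpace Ω] (α : ℝ) (ν : Measure Ω)
    [IsProbabilityMeasure ν] : renyiMoment α ν ν = 1 := by
  have h := renyiMoment_withDensity α (ν := ν) (f := fun _ => 1) measurable_const
  simpa using h

lemma absolutelyContinuous_bind {Ω Ω' : Type*} [MeasurableSpace Ω] [MeasurableSpace Ω']
    {μ ν : Measure Ω} {κ : Ω → Measure Ω'} (hκ : Measurable κ) (h : μ ≪ ν) :
    μ.bind κ ≪ ν.bind κ := by
  refine Measure.AbsolutelyContinuous.mk fun s hs h0 => ?_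
  rw [Measure.bind_apply hs hκ.aemeasurable] at h0 ⊢
  have hm : Measurable fun ω => κ ω s := (Measure.measurable_coe hs).comp hκ
  rw [lintegral_eq_zero_iff hm] at h0 ⊢
  exact h.ae_le h0

lemma isProbabilityMeasure_bind {Ω Ω' : Type*} [MeasurableSpace Ω] [MeasurableSpace Ω']
    {μ : Measure Ω} [IsProbabilityMeasure μ] {κ : Ω → Measure Ω'} (hκ : Measurable κ)
    (hκ1 : ∀ ω, IsProbabilityMeasure (κ ω)) : IsProbabilityMeasure (μ.bind κ) :=
  ⟨by simp [Measure.bind_apply .univ hκ.aemeasurable]⟩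

/-- Data processing for the `α`-moment. With `f = dμ/dν` and `g` the likelihood ratio of the images,
Young's inequality `f g^(α-1) ≤ f^α / α + (1 - 1/α) g^α` integrates to
`∫ g^α ≤ (1/α) ∫ f^α + (1 - 1/α) ∫ g^α`; truncating `g` makes the last term finite, so that it can
be absorbed. -/
lemma renyiMoment_bind_le {Ω Ω' : Type*} [MeasurableSpace Ω] [MeasurableSpace Ω'] {α : ℝ}
    (hα : 1 < α) {μ ν : Measure Ω} [IsProbabilityMeasure μ] [IsProbabilityMeasure ν]
    {κ : Ω → Measure Ω'} (hκ : Measurable κ) (hκ1 : ∀ ω, IsProbabilityMeasure (κ ω))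
    (h : μ ≪ ν) : renyiMoment α (μ.bind κ) (ν.bind κ) ≤ renyiMoment α μ ν := by
  have := isProbabilityMeasure_bind (μ := μ) hκ hκ1
  have := isProbabilityMeasure_bind (μ := ν) hκ hκ1
  have hac := absolutelyContinuous_bind hκ h
  set f := μ.rnDeriv ν with hf
  set g := (μ.bind κ).rnDeriv (ν.bind κ) with hg
  have hfm : Measurable f := Measure.measurable_rnDeriv _ _
  have hgm : Measurable g := Measure.measurable_rnDeriv _ _
  have hα0 : 0 < α := by linarith
  have hα1 : 0 < α - 1 := by linarith
  have key : ∀ n : ℕ, ∫⁻ y, (min (g y) n) ^ α ∂(ν.bind κ) ≤ renyiMoment α μ ν := by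
    intro n
    set k : Ω' → ℝ≥0∞ := fun y => min (g y) n with hk
    have hkm : Measurable k := hgm.min measurable_const
    have hkl : ∀ s : ℝ, Measurable fun x => ∫⁻ y, k y ^ s ∂(κ x) := fun s =>
      (Measure.measurable_lintegral (hkm.pow_const _)).comp hκ
    have hGfin : ∫⁻ y, k y ^ α ∂(ν.bind κ) ≠ ∞ := by
      refine ne_top_of_le_ne_top (b := (n : ℝ≥0∞) ^ α) (by simp [hα0.le]) ?_
      calc ∫⁻ y, k y ^ α ∂(ν.bind κ) ≤ ∫⁻ _, (n : ℝ≥0∞) ^ α ∂(ν.bind κ) :=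
            lintegral_mono fun y => ENNReal.rpow_le_rpow (min_le_right _ _) hα0.le
        _ = (n : ℝ≥0∞) ^ α := by simp
    have hpq : α.HolderConjugate (α / (α - 1)) := Real.HolderConjugate.conjExponent hα
    have hinv : (ENNReal.ofReal α)⁻¹ + (ENNReal.ofReal (α / (α - 1)))⁻¹ = 1 :=
      hpq.inv_add_inv_ennreal
    set p := (ENNReal.ofReal α)⁻¹
    set r := (ENNReal.ofReal (α / (α - 1)))⁻¹
    have hp0 : p ≠ 0 := by simp [p]
    have hr : r ≠ ∞ := ne_top_of_le_ne_top ENNReal.one_ne_top (hinv ▸ le_add_self)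
    have hp : p ≠ ∞ := ne_top_of_le_ne_top ENNReal.one_ne_top (hinv ▸ le_self_add)
    have h1 : ∫⁻ y, k y ^ α ∂(ν.bind κ) ≤
        p * renyiMoment α μ ν + r * ∫⁻ y, k y ^ α ∂(ν.bind κ) := by
      calc ∫⁻ y, k y ^ α ∂(ν.bind κ)
          ≤ ∫⁻ y, g y * k y ^ (α - 1) ∂(ν.bind κ) := by
            refine lintegral_mono fun y => ?_
            have hkn : k y ≠ ∞ := ne_top_of_le_ne_top (ENNReal.natCast_ne_top n) (min_le_right _ _)
            have : k y ^ α = k y * k y ^ (α - 1) := by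
              conv_lhs => rw [show α = 1 + (α - 1) by ring]
              rw [ENNReal.rpow_add_of_nonneg _ _ zero_le_one hα1.le, ENNReal.rpow_one]
            simp only [this]
            gcongr
            exact min_le_left _ _
        _ = ∫⁻ y, k y ^ (α - 1) ∂(μ.bind κ) := by
            rw [← Measure.withDensity_rnDeriv_eq _ _ hac,
              lintegral_withDensity_eq_lintegral_mul _ hgm (hkm.pow_const _)]
            simp [hg]
        _ = ∫⁻ x, f x * ∫⁻ y, k y ^ (α - 1) ∂(κ x) ∂ν := by
            rw [Measure.lintegral_bind hκ.aemeasurable (hkm.pow_const _).aemeasurable]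
            conv_lhs => rw [← Measure.withDensity_rnDeriv_eq _ _ h]
            rw [lintegral_withDensity_eq_lintegral_mul _ hfm (hkl _)]
            rfl
        _ ≤ ∫⁻ x, (p * f x ^ α + r * ∫⁻ y, k y ^ α ∂(κ x)) ∂ν := by
            refine lintegral_mono fun x => ?_
            rw [← lintegral_const_mul _ (hkm.pow_const _)]
            calc ∫⁻ y, f x * k y ^ (α - 1) ∂(κ x)
                ≤ ∫⁻ y, (p * f x ^ α + r * k y ^ α) ∂(κ x) := by
                  refine lintegral_mono fun y => ?_
                  have := ENNReal.young_inequality (f x) (k y ^ (α - 1)) hpq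
                  rw [← ENNReal.rpow_mul, mul_div_cancel₀ _ hα1.ne', ENNReal.div_eq_inv_mul,
                    ENNReal.div_eq_inv_mul] at this
                  exact this
              _ = p * f x ^ α + r * ∫⁻ y, k y ^ α ∂(κ x) := by
                  rw [lintegral_add_left measurable_const, lintegral_const,
                    lintegral_const_mul _ (hkm.pow_const _), measure_univ, mul_one]
        _ = p * renyiMoment α μ ν + r * ∫⁻ y, k y ^ α ∂(ν.bind κ) := by
            rw [lintegral_add_left ((hfm.pow_const _).const_mul _),
              lintegral_const_mul _ (hfm.pow_const _), lintegral_const_mul _ (hkl _),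
              Measure.lintegral_bind hκ.aemeasurable (hkm.pow_const _).aemeasurable]
            rfl
    set G := ∫⁻ y, k y ^ α ∂(ν.bind κ)
    have h2 : p * G + r * G ≤ p * renyiMoment α μ ν + r * G := by
      rwa [← add_mul, hinv, one_mul]
    exact (ENNReal.mul_le_mul_iff_right hp0 hp).1
      ((ENNReal.add_le_add_iff_right (ENNReal.mul_ne_top hr hGfin)).1 h2)
  have hlim : renyiMoment α (μ.bind κ) (ν.bind κ) =
      ⨆ n : ℕ, ∫⁻ y, (min (g y) n) ^ α ∂(ν.bind κ) := by
    rw [← lintegral_iSup (fun n => (hgm.min measurable_const).pow_const _)]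
    · refine lintegral_congr fun y => ?_
      have : (fun n : ℕ => (min (g y) (n : ℝ≥0∞)) ^ α) =
          fun n : ℕ => (ENNReal.orderIsoRpow α hα0) (min (g y) (n : ℝ≥0∞)) := rfl
      rw [this, ← OrderIso.map_iSup, ← inf_iSup_eq, ENNReal.iSup_natCast, inf_top_eq]
      rfl
    · intro m n hmn y
      exact ENNReal.rpow_le_rpow (min_le_min_left _ (by exact_mod_cast hmn)) hα0.le
  rw [hlim]
  exact iSup_le key

lemma renyiMoment_prod {Ω Ω' : Type*} [MeasurableSpace Ω] [MeasurableSpace Ω'] (α : ℝ)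
    (hα : 0 ≤ α) {μ ν : Measure Ω} {μ' ν' : Measure Ω'} [IsProbabilityMeasure μ]
    [IsProbabilityMeasure ν] [IsProbabilityMeasure μ'] [IsProbabilityMeasure ν']
    (h : μ ≪ ν) (h' : μ' ≪ ν') :
    renyiMoment α (μ.prod μ') (ν.prod ν') = renyiMoment α μ ν * renyiMoment α μ' ν' := by
  have hf := Measure.measurable_rnDeriv μ ν
  have hg := Measure.measurable_rnDeriv μ' ν'
  have e : μ.prod μ' =
      (ν.prod ν').withDensity fun z => μ.rnDeriv ν z.1 * μ'.rnDeriv ν' z.2 := by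
    rw [← prod_withDensity hf hg, Measure.withDensity_rnDeriv_eq _ _ h,
      Measure.withDensity_rnDeriv_eq _ _ h']
  rw [e, renyiMoment_withDensity _ (by fun_prop)]
  simp_rw [ENNReal.mul_rpow_of_nonneg _ _ hα]
  exact lintegral_prod_mul (hf.pow_const _).aemeasurable (hg.pow_const _).aemeasurable

/-! ### From Rényi to approximate differential privacy -/

/-- The pointwise inequality behind the conversion: `C x^α + t` dominates `x`, being tangent to it
at `w = α t / (α - 1)`. -/
lemma le_add_mul_rpow {α t x : ℝ} (hα : 1 < α) (ht : 0 < t) (hx : 0 ≤ x) :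
    x ≤ t + α⁻¹ * (α * t / (α - 1)) ^ (1 - α) * x ^ α := by
  have h1 : 0 < α - 1 := by linarith
  have h0 : 0 < α := by linarith
  set w := α * t / (α - 1) with hw
  have hw0 : 0 < w := by positivity
  have hb := one_add_mul_self_le_rpow_one_add (s := x / w - 1) (by
    have : 0 ≤ x / w := by positivity
    linarith) hα.le
  rw [add_sub_cancel, Real.div_rpow hx hw0.le] at hb
  have e1 : α⁻¹ * w ^ (1 - α) * x ^ α = w / α * (x ^ α / w ^ α) := by
    rw [Real.rpow_sub hw0, Real.rpow_one]
    field_simp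
  have e2 : w / α * (1 + α * (x / w - 1)) = x - t := by
    have : w * (α - 1) = α * t := by rw [hw]; field_simp
    field_simp
    linarith
  rw [e1]
  have := mul_le_mul_of_nonneg_left hb (by positivity : 0 ≤ w / α)
  linarith

lemma measure_le_of_renyiMoment_le {Ω : Type*} [MeasurableSpace Ω] {α ρ δ ε : ℝ} (hα : 1 < α)
    (hδ : 0 < δ) {μ ν : Measure Ω} [IsProbabilityMeasure μ] [IsProbabilityMeasure ν]
    (hac : μ ≪ ν) (h : renyiMoment α μ ν ≤ ENNReal.ofReal (Real.exp ((α - 1) * ρ)))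
    (hε : rdpToDP α ρ δ ≤ ε) (R : Set Ω) :
    μ R ≤ ENNReal.ofReal (Real.exp ε) * ν R + ENNReal.ofReal δ := by
  have h1 : 0 < α - 1 := by linarith
  have h0 : 0 < α := by linarith
  set t := Real.exp (rdpToDP α ρ δ) with ht
  have ht0 : 0 < t := Real.exp_pos _
  set C := α⁻¹ * (α * t / (α - 1)) ^ (1 - α) with hC
  have hC0 : 0 < C := by positivity
  -- The tangency constant is exactly the one for which the moment bound contributes `δ`.
  have hCδ : C * Real.exp ((α - 1) * ρ) = δ := by
    refine Real.log_injOn_pos (Set.mem_Ioi.2 (by positivity)) (Set.mem_Ioi.2 hδ) ?_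
    rw [hC, Real.log_mul (by positivity) (by positivity), Real.log_mul (by positivity)
      (by positivity), Real.log_rpow (by positivity), Real.log_exp, Real.log_inv,
      Real.log_div (by positivity) (by positivity), Real.log_mul (by positivity) (by positivity),
      ht, Real.log_exp, rdpToDP, Real.log_div (by positivity) (by positivity)]
    field_simp
    ring
  set f := μ.rnDeriv ν with hf
  have hfm : Measurable f := Measure.measurable_rnDeriv _ _
  have hpt : ∀ x : ℝ≥0∞, x ≤ ENNReal.ofReal t + ENNReal.ofReal C * x ^ α := by
    intro x
    induction x with
    | top => simp [ENNReal.top_rpow_of_pos h0, ENNReal.mul_top, hC0]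
    | coe x =>
      rw [← ENNReal.ofReal_coe_nnreal, ENNReal.ofReal_rpow_of_nonneg x.coe_nonneg h0.le,
        ← ENNReal.ofReal_mul hC0.le, ← ENNReal.ofReal_add ht0.le (by positivity)]
      exact ENNReal.ofReal_le_ofReal (le_add_mul_rpow hα ht0 x.coe_nonneg)
  calc μ R = ∫⁻ ω in R, f ω ∂ν := (Measure.setLIntegral_rnDeriv hac R).symm
    _ ≤ ∫⁻ ω in R, (ENNReal.ofReal t + ENNReal.ofReal C * f ω ^ α) ∂ν :=
        lintegral_mono fun ω => hpt _
    _ = ENNReal.ofReal t * ν R + ENNReal.ofReal C * ∫⁻ ω in R, f ω ^ α ∂ν := by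
        rw [lintegral_add_left measurable_const, lintegral_const_mul _ (hfm.pow_const _)]
        simp
    _ ≤ ENNReal.ofReal t * ν R + ENNReal.ofReal C * ENNReal.ofReal (Real.exp ((α - 1) * ρ)) := by
        gcongr
        exact (setLIntegral_le_lintegral _ _).trans h
    _ ≤ ENNReal.ofReal (Real.exp ε) * ν R + ENNReal.ofReal δ := by
        rw [← ENNReal.ofReal_mul hC0.le, hCδ]
        gcongr
        exact Real.exp_le_exp.2 hε

/-! ### One iteration as a post-processing of the scalar sampled Gaussian -/

/-- The factor `k` for which `z ↦ z - k ⟪v, z⟫ v` is a square root of `1 - v vᵀ`, when `‖v‖ ≤ 1`. -/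
def shrinkFactor {d : ℕ} (v : EuclideanSpace ℝ (Fin d)) : ℝ := (1 + √(1 - ‖v‖ ^ 2))⁻¹

/-- Extension of the scalar observation `y` to a vector: `y v` plus Gaussian noise of covariance
`σ² (1 - v vᵀ)`, generated from the standard Gaussian vector `z`. -/
def liftNoise {d : ℕ} (σ : ℝ) (v : EuclideanSpace ℝ (Fin d)) (y : ℝ)
    (z : EuclideanSpace ℝ (Fin d)) : EuclideanSpace ℝ (Fin d) :=
  y • v + σ • (z - (shrinkFactor v * inner ℝ v z) • v)

lemma norm_sub_shrinkFactor_sq {d : ℕ} {v : EuclideanSpace ℝ (Fin d)} (hv : ‖v‖ ≤ 1)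
    (t : EuclideanSpace ℝ (Fin d)) :
    ‖t - (shrinkFactor v * inner ℝ v t) • v‖ ^ 2 = ‖t‖ ^ 2 - inner ℝ v t ^ 2 := by
  have hw : √(1 - ‖v‖ ^ 2) ^ 2 = 1 - ‖v‖ ^ 2 :=
    Real.sq_sqrt (by nlinarith [norm_nonneg v])
  have hk : shrinkFactor v ^ 2 * ‖v‖ ^ 2 - 2 * shrinkFactor v + 1 = 0 := by
    unfold shrinkFactor
    set w := √(1 - ‖v‖ ^ 2)
    have hw0 : 0 ≤ w := Real.sqrt_nonneg _
    have : ‖v‖ ^ 2 = 1 - w ^ 2 := by linarith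
    rw [this]
    field_simp
    ring
  rw [norm_sub_sq_real, norm_smul, inner_smul_right, real_inner_comm v t, mul_pow,
    Real.norm_eq_abs, sq_abs]
  linear_combination inner ℝ v t ^ 2 * hk

/-- If `y ∼ N(a, σ²)` then the lifted observation is distributed as `a v + σ z`; comparison of
characteristic functions. -/
lemma map_liftNoise {d : ℕ} (a σ : ℝ) {v : EuclideanSpace ℝ (Fin d)} (hv : ‖v‖ ≤ 1) :
    ((gaussianReal a (σ ^ 2).toNNReal).prod (stdGaussian (EuclideanSpace ℝ (Fin d)))).map
        (fun w => liftNoise σ v w.1 w.2) =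
      (stdGaussian (EuclideanSpace ℝ (Fin d))).map (fun z => a • v + σ • z) := by
  have hm : Measurable fun w : ℝ × EuclideanSpace ℝ (Fin d) => liftNoise σ v w.1 w.2 := by
    unfold liftNoise
    fun_prop
  have := Measure.isProbabilityMeasure_map (μ := (gaussianReal a (σ ^ 2).toNNReal).prod
    (stdGaussian (EuclideanSpace ℝ (Fin d)))) hm.aemeasurable
  have hm2 : Measurable fun z : EuclideanSpace ℝ (Fin d) => a • v + σ • z := by fun_prop
  have := Measure.isProbabilityMeasure_map (μ := stdGaussian (EuclideanSpace ℝ (Fin d)))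
    hm2.aemeasurable
  refine Measure.ext_of_charFun ?_
  ext t
  rw [charFun_apply, charFun_apply, integral_map hm.aemeasurable (by fun_prop),
    integral_map hm2.aemeasurable (by fun_prop)]
  set s := σ • (t - (shrinkFactor v * inner ℝ v t) • v) with hs
  have e1 : ∀ w : ℝ × EuclideanSpace ℝ (Fin d),
      Complex.exp (inner ℝ (liftNoise σ v w.1 w.2) t * Complex.I) =
        Complex.exp (inner ℝ v t * w.1 * Complex.I) * Complex.exp (inner ℝ w.2 s * Complex.I) := by
    intro w
    rw [← Complex.exp_add, ← add_mul]
    congr 2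
    rw [hs, liftNoise]
    simp only [inner_add_left, inner_smul_left, inner_smul_right, inner_sub_left, inner_sub_right,
      real_inner_comm v w.2, conj_trivial]
    push_cast
    ring
  have e2 : ∀ z : EuclideanSpace ℝ (Fin d),
      Complex.exp (inner ℝ (a • v + σ • z) t * Complex.I) =
        Complex.exp (a * inner ℝ v t * Complex.I) *
          Complex.exp (inner ℝ z (σ • t) * Complex.I) := by
    intro z
    rw [← Complex.exp_add, ← add_mul]
    congr 2
    simp only [inner_add_left, inner_smul_left, inner_smul_right, conj_trivial]
    push_cast
    ring
  simp_rw [e1, e2]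
  rw [integral_prod_mul (fun y : ℝ => Complex.exp (inner ℝ v t * y * Complex.I))
    (fun z : EuclideanSpace ℝ (Fin d) => Complex.exp (inner ℝ z s * Complex.I)),
    integral_const_mul, ← charFun_apply, ← charFun_apply, ← charFun_apply_real,
    charFun_stdGaussian, charFun_stdGaussian, charFun_gaussianReal, ← Complex.exp_add,
    ← Complex.exp_add]
  congr 1
  have hns : ‖s‖ ^ 2 = σ ^ 2 * (‖t‖ ^ 2 - inner ℝ v t ^ 2) := by
    rw [hs, norm_smul, mul_pow, norm_sub_shrinkFactor_sq hv, Real.norm_eq_abs, sq_abs]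
  have hnt : ‖σ • t‖ ^ 2 = σ ^ 2 * ‖t‖ ^ 2 := by
    rw [norm_smul, mul_pow, Real.norm_eq_abs, sq_abs]
  rw [← Complex.ofReal_pow ‖s‖, hns, ← Complex.ofReal_pow ‖σ • t‖, hnt,
    Real.coe_toNNReal _ (sq_nonneg σ)]
  push_cast
  ring

/-- The clipped gradient of the point `x`, in units of the clip norm. -/
def unitGrad {X : Type*} {d : ℕ} (loss : EuclideanSpace ℝ (Fin d) → X → ℝ) (c : ℝ) (x : X)
    (θ : EuclideanSpace ℝ (Fin d)) : EuclideanSpace ℝ (Fin d) :=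
  c⁻¹ • clip c (gradient (fun ϑ => loss ϑ x) θ)

lemma norm_clip_le {d : ℕ} {c : ℝ} (hc : 0 < c) (g : EuclideanSpace ℝ (Fin d)) :
    ‖clip c g‖ ≤ c := by
  have h1 : 0 < max 1 (‖g‖ / c) := lt_max_of_lt_left one_pos
  rw [clip, norm_smul, norm_inv, Real.norm_of_nonneg h1.le, inv_mul_le_iff₀ h1,
    ← div_le_iff₀ hc]
  exact le_max_right _ _

lemma norm_unitGrad_le {X : Type*} {d : ℕ} (loss : EuclideanSpace ℝ (Fin d) → X → ℝ) {c : ℝ}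
    (hc : 0 < c) (x : X) (θ : EuclideanSpace ℝ (Fin d)) : ‖unitGrad loss c x θ‖ ≤ 1 := by
  rw [unitGrad, norm_smul, norm_inv, Real.norm_of_nonneg hc.le, inv_mul_le_iff₀ hc, mul_one]
  exact norm_clip_le hc _

lemma measurable_unitGrad {X : Type*} {d : ℕ} (loss : EuclideanSpace ℝ (Fin d) → X → ℝ) (c : ℝ)
    (x : X) : Measurable (unitGrad loss c x) := by
  have := measurable_clippedGradSum loss c {x}
  unfold clippedGradSum at this
  simp only [Finset.sum_singleton] at this
  exact Measurable.const_smul this c⁻¹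

/-- The update with mini-batch `L`, started at `w.1`, in which the contribution of the point `x` is
only visible through the scalar observation `w.2`. -/
def liftUpdate {X : Type*} {d : ℕ} (loss : EuclideanSpace ℝ (Fin d) → X → ℝ) (η B c σ : ℝ) (x : X)
    (L : Finset X) (w : EuclideanSpace ℝ (Fin d) × ℝ) (z : EuclideanSpace ℝ (Fin d)) :
    EuclideanSpace ℝ (Fin d) :=
  w.1 - η • B⁻¹ • (clippedGradSum loss c L w.1 +
    c • liftNoise σ (unitGrad loss c x w.1) w.2 z)

lemma measurable_liftUpdate {X : Type*} {d : ℕ} (loss : EuclideanSpace ℝ (Fin d) → X → ℝ)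
    (η B c σ : ℝ) (x : X) (L : Finset X) :
    Measurable (Function.uncurry (liftUpdate loss η B c σ x L)) := by
  have h := measurable_clippedGradSum loss c L
  have h' := measurable_unitGrad loss c x
  unfold liftUpdate Function.uncurry liftNoise shrinkFactor
  fun_prop

/-- The Markov kernel that produces the next parameters from the current ones and a scalar
observation: the mini-batch is drawn from `D`, and the observation, `N(0, σ²)` or `N(1, σ²)`,
decides whether the extra point `x` is in the batch. -/
def liftKernel {X : Type*} [DecidableEq X] {P d : ℕ} (grp : X → Fin P)
    (loss : EuclideanSpace ℝ (Fin d) → X → ℝ) (η B c σ : ℝ) (q : Fin P → ℝ)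
    (D : Finset X) (x : X) (w : EuclideanSpace ℝ (Fin d) × ℝ) :
    Measure (EuclideanSpace ℝ (Fin d)) :=
  ∑ L ∈ D.powerset, batchProb grp q D L •
    (stdGaussian (EuclideanSpace ℝ (Fin d))).map (liftUpdate loss η B c σ x L w)

lemma measurable_liftKernel {X : Type*} [DecidableEq X] {P d : ℕ} (grp : X → Fin P)
    (loss : EuclideanSpace ℝ (Fin d) → X → ℝ) (η B c σ : ℝ) (q : Fin P → ℝ) (D : Finset X) (x : X) :
    Measurable (liftKernel grp loss η B c σ q D x) := by
  refine Measure.measurable_of_measurable_coe _ fun s hs => ?_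
  simp only [liftKernel, Measure.finsetSum_apply, Measure.smul_apply, smul_eq_mul]
  refine Finset.measurable_fun_sum _ fun L _ => Measurable.const_mul ?_ _
  have h := measurable_liftUpdate loss η B c σ x L
  have h' : ∀ w, Measurable (liftUpdate loss η B c σ x L w) := fun w => h.of_uncurry_left
  simp only [Measure.map_apply (h' _) hs]
  exact measurable_measure_prodMk_left (h hs)

lemma sum_batchProb {X : Type*} [DecidableEq X] {P : ℕ} (grp : X → Fin P) {q : Fin P → ℝ}
    (hq : ∀ p, 0 ≤ q p ∧ q p ≤ 1) (D : Finset X) :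
    ∑ L ∈ D.powerset, batchProb grp q D L = 1 := by
  unfold batchProb
  rw [← ENNReal.ofReal_sum_of_nonneg, ← Finset.prod_add]
  · simp
  · intro L _
    exact mul_nonneg (Finset.prod_nonneg fun x _ => (hq _).1)
      (Finset.prod_nonneg fun x _ => sub_nonneg.2 (hq _).2)

lemma isProbabilityMeasure_liftKernel {X : Type*} [DecidableEq X] {P d : ℕ} (grp : X → Fin P)
    (loss : EuclideanSpace ℝ (Fin d) → X → ℝ) (η B c σ : ℝ) {q : Fin P → ℝ}
    (hq : ∀ p, 0 ≤ q p ∧ q p ≤ 1) (D : Finset X) (x : X) (w : EuclideanSpace ℝ (Fin d) × ℝ) :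
    IsProbabilityMeasure (liftKernel grp loss η B c σ q D x w) := by
  constructor
  have h' : ∀ L, Measurable (liftUpdate loss η B c σ x L w) := fun L =>
    (measurable_liftUpdate loss η B c σ x L).of_uncurry_left
  simp only [liftKernel, Measure.finsetSum_apply, Measure.smul_apply, smul_eq_mul,
    Measure.map_apply (h' _) .univ, Set.preimage_univ, measure_univ, mul_one]
  exact sum_batchProb grp hq D

lemma isProbabilityMeasure_stepLaw {X : Type*} [DecidableEq X] {P d : ℕ} (grp : X → Fin P)
    (loss : EuclideanSpace ℝ (Fin d) → X → ℝ) (η B c σ : ℝ) {q : Fin P → ℝ}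
    (hq : ∀ p, 0 ≤ q p ∧ q p ≤ 1) (D : Finset X) (θ : EuclideanSpace ℝ (Fin d)) :
    IsProbabilityMeasure (stepLaw grp loss η B c σ q D θ) := by
  constructor
  have h' : ∀ L, Measurable (update loss η B c σ L θ) := fun L =>
    (measurable_update loss η B c σ L).of_uncurry_left
  simp only [stepLaw, Measure.finsetSum_apply, Measure.smul_apply, smul_eq_mul,
    Measure.map_apply (h' _) .univ, Set.preimage_univ, measure_univ, mul_one]
  exact sum_batchProb grp hq D

/-- A scalar observation `N(a, σ²)` simulates the updates in which `x` has weight `a`. -/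
lemma lintegral_liftKernel_gaussian {X : Type*} [DecidableEq X] {P d : ℕ} (grp : X → Fin P)
    (loss : EuclideanSpace ℝ (Fin d) → X → ℝ) (η B : ℝ) {c : ℝ} (hc : 0 < c) (σ : ℝ)
    (q : Fin P → ℝ) (D : Finset X) (x : X) (θ : EuclideanSpace ℝ (Fin d)) (a : ℝ)
    {s : Set (EuclideanSpace ℝ (Fin d))} (hs : MeasurableSet s) :
    ∫⁻ y, liftKernel grp loss η B c σ q D x (θ, y) s ∂(gaussianReal a (σ ^ 2).toNNReal) =
      ∑ L ∈ D.powerset, batchProb grp q D L *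
        (stdGaussian (EuclideanSpace ℝ (Fin d))).map
          (fun z => θ - η • B⁻¹ • (clippedGradSum loss c L θ +
            c • (a • unitGrad loss c x θ + σ • z))) s := by
  have h := fun L => measurable_liftUpdate loss η B c σ x L
  have h' : ∀ L w, Measurable (liftUpdate loss η B c σ x L w) := fun L w => (h L).of_uncurry_left
  simp only [liftKernel, Measure.finsetSum_apply, Measure.smul_apply, smul_eq_mul,
    Measure.map_apply (h' _ _) hs]
  have hm : ∀ L, Measurable fun y : ℝ =>
      stdGaussian (EuclideanSpace ℝ (Fin d)) (liftUpdate loss η B c σ x L (θ, y) ⁻¹' s) := fun L =>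
    (measurable_measure_prodMk_left (h L hs)).comp measurable_prodMk_left
  rw [lintegral_finsetSum _ fun L _ => (hm L).const_mul _]
  refine Finset.sum_congr rfl fun L _ => ?_
  rw [lintegral_const_mul _ (hm L)]
  congr 1
  set T : EuclideanSpace ℝ (Fin d) → EuclideanSpace ℝ (Fin d) := fun u =>
    θ - η • B⁻¹ • (clippedGradSum loss c L θ + c • u) with hT
  have hTm : Measurable T := by fun_prop
  have hl : Measurable fun w : ℝ × EuclideanSpace ℝ (Fin d) =>
      liftNoise σ (unitGrad loss c x θ) w.1 w.2 := by
    unfold liftNoise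
    fun_prop
  have hr : Measurable fun z : EuclideanSpace ℝ (Fin d) =>
    a • unitGrad loss c x θ + σ • z := by fun_prop
  have e : (fun z => θ - η • B⁻¹ • (clippedGradSum loss c L θ +
      c • (a • unitGrad loss c x θ + σ • z))) = T ∘ fun z => a • unitGrad loss c x θ + σ • z := rfl
  rw [e, ← Measure.map_map hTm hr, ← map_liftNoise a σ (norm_unitGrad_le loss hc x θ),
    Measure.map_map hTm hl, Measure.map_apply (hTm.comp hl) hs,
    Measure.prod_apply ((hTm.comp hl) hs)]
  rfl

lemma stepLaw_eq_lintegral {X : Type*} [DecidableEq X] {P d : ℕ} (grp : X → Fin P)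
    (loss : EuclideanSpace ℝ (Fin d) → X → ℝ) (η B : ℝ) {c : ℝ} (hc : 0 < c) (σ : ℝ)
    (q : Fin P → ℝ) (D : Finset X) (x : X) (θ : EuclideanSpace ℝ (Fin d))
    {s : Set (EuclideanSpace ℝ (Fin d))} (hs : MeasurableSet s) :
    stepLaw grp loss η B c σ q D θ s =
      ∫⁻ y, liftKernel grp loss η B c σ q D x (θ, y) s ∂(gaussianReal 0 (σ ^ 2).toNNReal) := by
  rw [lintegral_liftKernel_gaussian grp loss η B hc σ q D x θ 0 hs]
  simp only [stepLaw, Measure.finsetSum_apply, Measure.smul_apply, smul_eq_mul]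
  refine Finset.sum_congr rfl fun L _ => ?_
  congr 3
  ext1 z
  simp [update, smul_smul, mul_comm σ c]

/-- On `D ∪ {x}`, the batch law is the one of `D`, with `x` added with probability `q`. -/
lemma stepLaw_insert_eq_lintegral {X : Type*} [DecidableEq X] {P d : ℕ} (grp : X → Fin P)
    (loss : EuclideanSpace ℝ (Fin d) → X → ℝ) (η B : ℝ) {c : ℝ} (hc : 0 < c) (σ : ℝ)
    {q : Fin P → ℝ} (hq : ∀ p, 0 ≤ q p ∧ q p ≤ 1) {D : Finset X} {x : X} (hx : x ∉ D)
    (θ : EuclideanSpace ℝ (Fin d)) {s : Set (EuclideanSpace ℝ (Fin d))} (hs : MeasurableSet s) :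
    stepLaw grp loss η B c σ q (insert x D) θ s =
      ∫⁻ y, liftKernel grp loss η B c σ q D x (θ, y) s ∂(sgmMixture (q (grp x)) σ) := by
  rw [sgmMixture, lintegral_add_measure, lintegral_smul_measure, lintegral_smul_measure,
    lintegral_liftKernel_gaussian grp loss η B hc σ q D x θ 0 hs,
    lintegral_liftKernel_gaussian grp loss η B hc σ q D x θ 1 hs]
  simp only [stepLaw, Measure.finsetSum_apply, Measure.smul_apply, smul_eq_mul]
  rw [Finset.sum_powerset_insert hx, Finset.mul_sum, Finset.mul_sum]
  congr 1
  · refine Finset.sum_congr rfl fun L hL => ?_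
    have hxL : x ∉ L := fun h => hx (Finset.mem_powerset.1 hL h)
    rw [← mul_assoc]
    congr 1
    · unfold batchProb
      rw [← ENNReal.ofReal_mul (sub_nonneg.2 (hq _).2), Finset.insert_sdiff_of_notMem _ hxL,
        Finset.prod_insert (fun h => hx (Finset.mem_sdiff.1 h).1)]
      congr 1
      ring
    · congr 2
      ext1 z
      simp [update, smul_smul, mul_comm σ c]
  · refine Finset.sum_congr rfl fun L hL => ?_
    have hxL : x ∉ L := fun h => hx (Finset.mem_powerset.1 hL h)
    rw [← mul_assoc]
    congr 1
    · unfold batchProb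
      rw [← ENNReal.ofReal_mul (hq _).1, Finset.prod_insert hxL,
        Finset.insert_sdiff_insert, Finset.sdiff_insert_of_notMem hx, mul_assoc]
    · congr 2
      ext1 z
      have : c • unitGrad loss c x θ = clip c (gradient (fun ϑ => loss ϑ x) θ) := by
        rw [unitGrad, smul_smul, mul_inv_cancel₀ hc.ne', one_smul]
      simp only [update, clippedGradSum, Finset.sum_insert hxL, one_smul, smul_add, this, smul_smul,
        mul_comm σ c]
      abel

lemma isProbabilityMeasure_sgmMixture {q σ : ℝ} (hq : 0 ≤ q ∧ q ≤ 1) :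
    IsProbabilityMeasure (sgmMixture q σ) := by
  constructor
  simp only [sgmMixture, Measure.add_apply, Measure.smul_apply, measure_univ, smul_eq_mul, mul_one]
  rw [← ENNReal.ofReal_add (sub_nonneg.2 hq.2) hq.1]
  simp

/-! ### Composition over the iterations -/

lemma bind_eq_prod_bind {Ω Ω' : Type*} [MeasurableSpace Ω] [MeasurableSpace Ω'] {μ : Measure Ω}
    [SFinite μ] {S : Measure Ω'} [SFinite S] {K : Ω → Measure Ω} (hK : Measurable K)
    {κ : Ω × Ω' → Measure Ω} (hκ : Measurable κ)
    (h : ∀ ω s, MeasurableSet s → K ω s = ∫⁻ y, κ (ω, y) s ∂S) :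
    μ.bind K = (μ.prod S).bind κ := by
  ext s hs
  have hm : Measurable fun w => κ w s := (Measure.measurable_coe hs).comp hκ
  rw [Measure.bind_apply hs hK.aemeasurable, Measure.bind_apply hs hκ.aemeasurable,
    lintegral_prod _ hm.aemeasurable]
  exact lintegral_congr fun ω => h ω s hs

lemma isProbabilityMeasure_sampleMechanism {X : Type*} [DecidableEq X] {P d : ℕ} (grp : X → Fin P)
    (loss : EuclideanSpace ℝ (Fin d) → X → ℝ) (init : Measure (EuclideanSpace ℝ (Fin d)))
    [IsProbabilityMeasure init] (η B c σ : ℝ) {q : Fin P → ℝ} (hq : ∀ p, 0 ≤ q p ∧ q p ≤ 1)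
    (t : ℕ) (D : Finset X) :
    IsProbabilityMeasure (sampleMechanism grp loss init η B c σ q t D) := by
  induction t with
  | zero => assumption
  | succ t ih =>
    exact isProbabilityMeasure_bind (measurable_stepLaw grp loss η B c σ q D)
      (isProbabilityMeasure_stepLaw grp loss η B c σ hq D)

/-- A common step of two iterated processes: if both one-step kernels are the image under the same
Markov kernel `κ` of an independent observation with law `S` respectively `T`, then a step
multiplies the `α`-moment by at most that of `(S, T)`. -/
lemma renyiMoment_step_le {Ω Ω' : Type*} [MeasurableSpace Ω] [MeasurableSpace Ω'] {α : ℝ}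
    (hα : 1 < α) {μ ν : Measure Ω} [IsProbabilityMeasure μ] [IsProbabilityMeasure ν]
    {S T : Measure Ω'} [IsProbabilityMeasure S] [IsProbabilityMeasure T]
    {K K' : Ω → Measure Ω} (hK : Measurable K) (hK' : Measurable K')
    {κ : Ω × Ω' → Measure Ω} (hκ : Measurable κ) (hκ1 : ∀ w, IsProbabilityMeasure (κ w))
    (h : ∀ ω s, MeasurableSet s → K ω s = ∫⁻ y, κ (ω, y) s ∂S)
    (h' : ∀ ω s, MeasurableSet s → K' ω s = ∫⁻ y, κ (ω, y) s ∂T)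
    (hμν : μ ≪ ν) (hST : S ≪ T) :
    μ.bind K ≪ ν.bind K' ∧
      renyiMoment α (μ.bind K) (ν.bind K') ≤ renyiMoment α μ ν * renyiMoment α S T := by
  rw [bind_eq_prod_bind hK hκ h, bind_eq_prod_bind hK' hκ h',
    ← renyiMoment_prod α (by linarith) hμν hST]
  have hac : μ.prod S ≪ ν.prod T := hμν.prod hST
  exact ⟨absolutelyContinuous_bind hκ hac, renyiMoment_bind_le hα hκ hκ1 hac⟩

/-- The divergence of the mechanism on neighbouring datasets is at most `t` times that of the scalar
sampled Gaussian mechanism, in both directions. -/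
lemma renyiDiv_sampleMechanism_le {X : Type*} [DecidableEq X] {P d : ℕ} (grp : X → Fin P)
    (loss : EuclideanSpace ℝ (Fin d) → X → ℝ) (init : Measure (EuclideanSpace ℝ (Fin d)))
    [IsProbabilityMeasure init] (η B : ℝ) {c : ℝ} (hc : 0 < c) (σ : ℝ) {q : Fin P → ℝ}
    (hq : ∀ p, 0 ≤ q p ∧ q p ≤ 1) {D : Finset X} {x : X} (hx : x ∉ D) {α ρ : ℝ} (hα : 1 < α)
    (hρ : sgmRenyi (q (grp x)) σ α ≤ (ρ : EReal)) (t : ℕ) :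
    renyiDiv α (sampleMechanism grp loss init η B c σ q t (insert x D))
        (sampleMechanism grp loss init η B c σ q t D) ≤ ((t * ρ : ℝ) : EReal) ∧
      renyiDiv α (sampleMechanism grp loss init η B c σ q t D)
        (sampleMechanism grp loss init η B c σ q t (insert x D)) ≤ ((t * ρ : ℝ) : EReal) := by
  rw [sgmRenyi, max_le_iff, renyiDiv_le_iff hα, renyiDiv_le_iff hα] at hρ
  obtain ⟨⟨hac, hm⟩, ⟨hac', hm'⟩⟩ := hρ
  have := isProbabilityMeasure_sgmMixture (σ := σ) (hq (grp x))
  have hpow : ∀ t : ℕ, ENNReal.ofReal (Real.exp ((α - 1) * ((t + 1 : ℕ) * ρ))) =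
      ENNReal.ofReal (Real.exp ((α - 1) * (t * ρ))) *
        ENNReal.ofReal (Real.exp ((α - 1) * ρ)) := by
    intro t
    rw [← ENNReal.ofReal_mul (Real.exp_pos _).le, ← Real.exp_add]
    push_cast
    ring_nf
  rw [renyiDiv_le_iff hα, renyiDiv_le_iff hα]
  induction t with
  | zero => simp [sampleMechanism, renyiMoment_self, Measure.AbsolutelyContinuous.rfl]
  | succ t ih =>
    have hM := isProbabilityMeasure_sampleMechanism grp loss init η B c σ hq t
    have := hM D
    have := hM (insert x D)
    have hκ := measurable_liftKernel grp loss η B c σ q D x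
    have hκ1 := isProbabilityMeasure_liftKernel grp loss η B c σ hq D x
    have hK := measurable_stepLaw grp loss η B c σ q
    have h := fun θ s hs => stepLaw_insert_eq_lintegral grp loss η B hc σ hq hx θ (s := s) hs
    have h' := fun θ s hs => stepLaw_eq_lintegral grp loss η B hc σ q D x θ (s := s) hs
    rw [hpow]
    obtain ⟨⟨i1, i2⟩, ⟨i3, i4⟩⟩ := ih
    have s1 := renyiMoment_step_le hα (hK (insert x D)) (hK D) hκ hκ1 h h' i1 hac
    have s2 := renyiMoment_step_le hα (hK D) (hK (insert x D)) hκ hκ1 h' h i3 hac'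
    exact ⟨⟨s1.1, s1.2.trans (mul_le_mul' i2 hm)⟩, ⟨s2.1, s2.2.trans (mul_le_mul' i4 hm')⟩⟩

/-! ### Likelihood ratios of the scalar sampled Gaussian -/

/-- The likelihood ratio of `N(1, σ²)` to `N(0, σ²)`. -/
def gaussianRatio (σ z : ℝ) : ℝ := Real.exp ((z - 1 / 2) / σ ^ 2)

/-- The likelihood ratio of `(1 - q) N(0, σ²) + q N(1, σ²)` to `N(0, σ²)`. -/
def sgmRatio (q σ z : ℝ) : ℝ := 1 - q + q * gaussianRatio σ z

lemma gaussianRatio_pos (σ z : ℝ) : 0 < gaussianRatio σ z := Real.exp_pos _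

lemma sgmRatio_pos {q : ℝ} (hq : 0 < q ∧ q ≤ 1) (σ z : ℝ) : 0 < sgmRatio q σ z := by
  have := mul_pos hq.1 (gaussianRatio_pos σ z)
  unfold sgmRatio
  linarith [hq.2]

@[fun_prop]
lemma measurable_gaussianRatio (σ : ℝ) : Measurable (gaussianRatio σ) := by
  unfold gaussianRatio
  fun_prop

@[fun_prop]
lemma measurable_sgmRatio (q σ : ℝ) : Measurable (sgmRatio q σ) := by
  unfold sgmRatio
  fun_prop

lemma gaussianReal_one_eq_withDensity {σ : ℝ} (hσ : 0 < σ) :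
    gaussianReal 1 (σ ^ 2).toNNReal = (gaussianReal 0 (σ ^ 2).toNNReal).withDensity
      fun z => ENNReal.ofReal (gaussianRatio σ z) := by
  have hv : (σ ^ 2).toNNReal ≠ 0 := by simp [hσ.ne']
  rw [gaussianReal_of_var_ne_zero _ hv, gaussianReal_of_var_ne_zero _ hv,
    ← withDensity_mul _ (by fun_prop) (by fun_prop)]
  congr 1
  ext z
  rw [Pi.mul_apply, gaussianPDF, gaussianPDF,
    ← ENNReal.ofReal_mul (gaussianPDFReal_nonneg _ _ _), gaussianPDFReal, gaussianPDFReal,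
    mul_assoc (√_)⁻¹, gaussianRatio, ← Real.exp_add, Real.coe_toNNReal _ (sq_nonneg σ)]
  congr 3
  field_simp
  ring

lemma sgmMixture_eq_withDensity {q σ : ℝ} (hq : 0 < q ∧ q ≤ 1) (hσ : 0 < σ) :
    sgmMixture q σ = (gaussianReal 0 (σ ^ 2).toNNReal).withDensity
      fun z => ENNReal.ofReal (sgmRatio q σ z) := by
  have e : (fun z => ENNReal.ofReal (sgmRatio q σ z)) =
      (fun _ => ENNReal.ofReal (1 - q)) +
        (ENNReal.ofReal q • fun z => ENNReal.ofReal (gaussianRatio σ z)) := by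
    ext z
    rw [sgmRatio, ENNReal.ofReal_add (sub_nonneg.2 hq.2)
      (mul_nonneg hq.1.le (gaussianRatio_pos σ z).le), ENNReal.ofReal_mul hq.1.le]
    rfl
  rw [sgmMixture, gaussianReal_one_eq_withDensity hσ, e, withDensity_add_left measurable_const,
    withDensity_const, withDensity_smul _ (by fun_prop)]

lemma renyiMoment_sgmMixture {q σ α : ℝ} (hq : 0 < q ∧ q ≤ 1) (hσ : 0 < σ) :
    renyiMoment α (sgmMixture q σ) (gaussianReal 0 (σ ^ 2).toNNReal) =
      ∫⁻ z, ENNReal.ofReal (sgmRatio q σ z ^ α) ∂(gaussianReal 0 (σ ^ 2).toNNReal) := by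
  rw [sgmMixture_eq_withDensity hq hσ, renyiMoment_withDensity _ (by fun_prop)]
  exact lintegral_congr fun z => ENNReal.ofReal_rpow_of_pos (sgmRatio_pos hq σ z)

lemma gaussianReal_eq_withDensity_sgmMixture {q σ : ℝ} (hq : 0 < q ∧ q ≤ 1) (hσ : 0 < σ) :
    gaussianReal 0 (σ ^ 2).toNNReal = (sgmMixture q σ).withDensity
      fun z => (ENNReal.ofReal (sgmRatio q σ z))⁻¹ := by
  rw [sgmMixture_eq_withDensity hq hσ]
  exact (withDensity_inv_same (by fun_prop)
    (ae_of_all _ fun z => by simpa using sgmRatio_pos hq σ z) (ae_of_all _ fun z => by simp)).symm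

lemma renyiMoment_gaussianReal_sgmMixture {q σ α : ℝ} (hq : 0 < q ∧ q ≤ 1) (hσ : 0 < σ) :
    renyiMoment α (gaussianReal 0 (σ ^ 2).toNNReal) (sgmMixture q σ) =
      ∫⁻ z, ENNReal.ofReal (sgmRatio q σ z ^ (1 - α)) ∂(gaussianReal 0 (σ ^ 2).toNNReal) := by
  have := isProbabilityMeasure_sgmMixture (σ := σ) ⟨hq.1.le, hq.2⟩
  conv_lhs => rw [gaussianReal_eq_withDensity_sgmMixture hq hσ]
  rw [renyiMoment_withDensity _ (by fun_prop), sgmMixture_eq_withDensity hq hσ,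
    lintegral_withDensity_eq_lintegral_mul _ (by fun_prop) (by fun_prop)]
  refine lintegral_congr fun z => ?_
  have h := sgmRatio_pos hq σ z
  rw [Pi.mul_apply, ← ENNReal.ofReal_inv_of_pos h, ENNReal.ofReal_rpow_of_pos (inv_pos.2 h),
    ← ENNReal.ofReal_mul h.le, Real.inv_rpow h.le, Real.rpow_sub h, Real.rpow_one, div_eq_mul_inv]

/-! ### The two divergences of the scalar mechanism -/

lemma convexOn_rpow_sub_rpow {α : ℝ} (hα : 1 < α) :
    ConvexOn ℝ (Set.Ici 1) fun x : ℝ => x ^ α - x ^ (1 - α) := by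
  have hd : ∀ x : ℝ, 1 < x → HasDerivAt (fun x : ℝ => x ^ α - x ^ (1 - α))
      (α * x ^ (α - 1) - (1 - α) * x ^ (-α)) x := by
    intro x hx
    have h1 := Real.hasDerivAt_rpow_const (x := x) (p := α) (Or.inl (by linarith))
    have h2 := Real.hasDerivAt_rpow_const (x := x) (p := 1 - α) (Or.inl (by linarith))
    rw [show 1 - α - 1 = -α by ring] at h2
    exact h1.sub h2
  have hd2 : ∀ x : ℝ, 1 < x → HasDerivAt (fun x : ℝ => α * x ^ (α - 1) - (1 - α) * x ^ (-α))
      (α * ((α - 1) * x ^ (α - 1 - 1)) - (1 - α) * (-α * x ^ (-α - 1))) x := by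
    intro x hx
    have h1 := Real.hasDerivAt_rpow_const (x := x) (p := α - 1) (Or.inl (by linarith))
    have h2 := Real.hasDerivAt_rpow_const (x := x) (p := -α) (Or.inl (by linarith))
    exact (h1.const_mul _).sub (h2.const_mul _)
  refine MonotoneOn.convexOn_of_deriv (convex_Ici 1) ?_ ?_ ?_
  · refine ContinuousOn.sub ?_ ?_
    all_goals
      refine ContinuousOn.rpow_const continuousOn_id fun x hx => Or.inl ?_
      exact (zero_lt_one.trans_le (Set.mem_Ici.1 hx)).ne'
  · rw [interior_Ici]
    exact fun x hx => (hd x hx).differentiableAt.differentiableWithinAt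
  · rw [interior_Ici]
    have hm : MonotoneOn (fun x : ℝ => α * x ^ (α - 1) - (1 - α) * x ^ (-α)) (Set.Ioi 1) := by
      refine monotoneOn_of_deriv_nonneg (convex_Ioi 1)
        (fun x hx => (hd2 x hx).continuousAt.continuousWithinAt) ?_ ?_
      · rw [interior_Ioi]
        exact fun x hx => (hd2 x hx).differentiableAt.differentiableWithinAt
      · rw [interior_Ioi]
        intro x hx
        rw [(hd2 x hx).deriv]
        have hx1 : (1 : ℝ) < x := hx
        have : x ^ (-α - 1) ≤ x ^ (α - 1 - 1) :=
          Real.rpow_le_rpow_of_exponent_le hx1.le (by linarith)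
        have hc : 0 ≤ α * (α - 1) := mul_nonneg (by linarith) (by linarith)
        nlinarith [mul_le_mul_of_nonneg_left this hc]
    exact hm.congr fun x hx => ((hd x hx).deriv).symm

/-- With `φ x = x^α - x^(1-α)`, so that `φ 1 = 0` and `φ (1/b) = - φ b / b`, this is the comparison
of the slopes of the convex function `φ` between `1` and `1/b`, and between `1` and `a ≥ 1/b`. -/
lemma rpow_add_mul_rpow_le_of_one_le {α q r : ℝ} (hα : 1 < α) (hq : 0 < q ∧ q ≤ 1) (hr : 1 ≤ r) :
    (1 - q + q * r) ^ (1 - α) + r * (1 - q + q * r⁻¹) ^ (1 - α) ≤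
      (1 - q + q * r) ^ α + r * (1 - q + q * r⁻¹) ^ α := by
  have hr0 : 0 < r := by linarith
  have hri : r⁻¹ ≤ 1 := inv_le_one_of_one_le₀ hr
  have hri0 : 0 < r⁻¹ := inv_pos.2 hr0
  have hrr : r * r⁻¹ = 1 := mul_inv_cancel₀ hr0.ne'
  set a := 1 - q + q * r with ha
  set b := 1 - q + q * r⁻¹ with hb
  have hq1 : 0 ≤ 1 - q := by linarith [hq.2]
  have ha1 : 1 ≤ a := by nlinarith [hq.1]
  have hb0 : 0 < b := by nlinarith [hq.1, mul_pos hq.1 hri0]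
  have hb1 : b ≤ 1 := by nlinarith [hq.1]
  have hab : 1 ≤ a * b := by
    have h2 : 2 ≤ r + r⁻¹ := by
      nlinarith [sq_nonneg (r - 1), mul_nonneg hri0.le (sq_nonneg (r - 1))]
    have : a * b = (1 - q) ^ 2 + q ^ 2 + q * (1 - q) * (r + r⁻¹) := by
      rw [ha, hb]
      linear_combination q ^ 2 * hrr
    rw [this]
    nlinarith [mul_le_mul_of_nonneg_left h2 (mul_nonneg hq.1.le hq1)]
  have hrb : r * (1 - b) = a - 1 := by
    rw [ha, hb]
    linear_combination -q * hrr
  have hφa : 0 ≤ a ^ α - a ^ (1 - α) :=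
    sub_nonneg.2 (Real.rpow_le_rpow_of_exponent_le ha1 (by linarith))
  have hc : b ^ (1 - α) - b ^ α = b * (b⁻¹ ^ α - b⁻¹ ^ (1 - α)) := by
    rw [Real.inv_rpow hb0.le, Real.inv_rpow hb0.le, ← Real.rpow_neg hb0.le, ← Real.rpow_neg hb0.le,
      mul_sub]
    nth_rw 3 [← Real.rpow_one b]
    nth_rw 5 [← Real.rpow_one b]
    rw [← Real.rpow_add hb0, ← Real.rpow_add hb0]
    ring_nf
  suffices r * (b ^ (1 - α) - b ^ α) ≤ a ^ α - a ^ (1 - α) by linarith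
  rcases hb1.eq_or_lt with h | h
  · simpa [h] using hφa
  have hc1 : 1 < b⁻¹ := (one_lt_inv₀ hb0).2 h
  have hca : b⁻¹ ≤ a := by rwa [inv_le_iff_one_le_mul₀ hb0]
  have hs := (convexOn_rpow_sub_rpow hα).secant_mono (a := 1) (x := b⁻¹) (y := a)
    Set.self_mem_Ici hc1.le ha1 hc1.ne' (hc1.trans_le hca).ne' hca
  simp only [Real.one_rpow, sub_self, sub_zero] at hs
  have ha1' : 0 < a - 1 := by linarith
  rw [div_le_div_iff₀ (by linarith) ha1'] at hs
  have hbc : b * (b⁻¹ - 1) = 1 - b := by field_simp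
  rw [hc]
  set φc := b⁻¹ ^ α - b⁻¹ ^ (1 - α)
  have hcpos : 0 < b⁻¹ - 1 := by linarith
  refine le_of_mul_le_mul_right ?_ hcpos
  calc r * (b * φc) * (b⁻¹ - 1) = φc * (r * (b * (b⁻¹ - 1))) := by ring
    _ = φc * (a - 1) := by rw [hbc, hrb]
    _ ≤ _ := hs

lemma rpow_add_mul_rpow_le {α q r : ℝ} (hα : 1 < α) (hq : 0 < q ∧ q ≤ 1) (hr : 0 < r) :
    (1 - q + q * r) ^ (1 - α) + r * (1 - q + q * r⁻¹) ^ (1 - α) ≤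
      (1 - q + q * r) ^ α + r * (1 - q + q * r⁻¹) ^ α := by
  rcases le_total 1 r with h | h
  · exact rpow_add_mul_rpow_le_of_one_le hα hq h
  · have := rpow_add_mul_rpow_le_of_one_le hα hq ((one_le_inv₀ hr).2 h)
    rw [inv_inv] at this
    have h2 := mul_le_mul_of_nonneg_left this hr.le
    rw [mul_add, mul_add, ← mul_assoc, ← mul_assoc, mul_inv_cancel₀ hr.ne', one_mul, one_mul] at h2
    linarith

/-- Integration against `N(0, σ²)`, after the reflection `z ↦ 1 - z` that exchanges `N(0, σ²)` and
`N(1, σ²)`. -/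
lemma lintegral_gaussian_reflect {σ : ℝ} (hσ : 0 < σ) {F : ℝ → ℝ≥0∞} (hF : Measurable F) :
    ∫⁻ z, F z ∂(gaussianReal 0 (σ ^ 2).toNNReal) =
      ∫⁻ z, ENNReal.ofReal (gaussianRatio σ z) * F (1 - z)
        ∂(gaussianReal 0 (σ ^ 2).toNNReal) := by
  have h : (gaussianReal 1 (σ ^ 2).toNNReal).map (1 - ·) = gaussianReal 0 (σ ^ 2).toNNReal := by
    rw [gaussianReal_map_const_sub, sub_self]
  conv_lhs => rw [← h]
  rw [lintegral_map hF (by fun_prop), gaussianReal_one_eq_withDensity hσ,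
    lintegral_withDensity_eq_lintegral_mul _ (by fun_prop) (by fun_prop)]
  rfl

lemma gaussianRatio_one_sub (σ z : ℝ) : gaussianRatio σ (1 - z) = (gaussianRatio σ z)⁻¹ := by
  rw [gaussianRatio, gaussianRatio, ← Real.exp_neg]
  congr 1
  ring

/-- The divergence of the mixture from the Gaussian dominates the one in the other direction: each
moment is averaged with its reflection, and the integrands are then compared pointwise. -/
lemma renyiMoment_gaussianReal_sgmMixture_le {q σ α : ℝ} (hα : 1 < α) (hq : 0 < q ∧ q ≤ 1)
    (hσ : 0 < σ) :
    renyiMoment α (gaussianReal 0 (σ ^ 2).toNNReal) (sgmMixture q σ) ≤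
      renyiMoment α (sgmMixture q σ) (gaussianReal 0 (σ ^ 2).toNNReal) := by
  rw [renyiMoment_sgmMixture hq hσ, renyiMoment_gaussianReal_sgmMixture hq hσ]
  have key : ∀ s : ℝ, 2 * ∫⁻ z, ENNReal.ofReal (sgmRatio q σ z ^ s)
      ∂(gaussianReal 0 (σ ^ 2).toNNReal) =
      ∫⁻ z, ENNReal.ofReal (sgmRatio q σ z ^ s + gaussianRatio σ z * sgmRatio q σ (1 - z) ^ s)
        ∂(gaussianReal 0 (σ ^ 2).toNNReal) := by
    intro s
    rw [two_mul]
    nth_rw 2 [lintegral_gaussian_reflect hσ (by fun_prop)]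
    rw [← lintegral_add_left (by fun_prop)]
    refine lintegral_congr fun z => ?_
    rw [← ENNReal.ofReal_mul (gaussianRatio_pos σ z).le, ← ENNReal.ofReal_add
      (Real.rpow_nonneg (sgmRatio_pos hq σ z).le _) (mul_nonneg (gaussianRatio_pos σ z).le
      (Real.rpow_nonneg (sgmRatio_pos hq σ _).le _))]
  refine (ENNReal.mul_le_mul_iff_right (a := 2) two_ne_zero (by simp)).1 ?_
  rw [key, key]
  refine lintegral_mono fun z => ENNReal.ofReal_le_ofReal ?_
  simp only [sgmRatio, gaussianRatio_one_sub]
  exact rpow_add_mul_rpow_le hα hq (gaussianRatio_pos σ z)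

/-! ### The closed-form bound -/

lemma one_add_rpow_le {α u : ℝ} (hα : 1 < α) (hu : -(1 / 2) ≤ u) (hu' : (α - 1) * u ≤ 1) :
    (1 + u) ^ α ≤ 1 + α * u + α * (α - 1) * u ^ 2 := by
  have hα1 : 0 < α - 1 := by linarith
  have hα0 : 0 < α := by linarith
  set φ : ℝ → ℝ := fun u => 1 + α * u + α * (α - 1) * u ^ 2 - (1 + u) ^ α with hφ
  have hd : ∀ x, -(1 / 2) ≤ x →
      HasDerivAt φ (α * (1 + 2 * ((α - 1) * x) - (1 + x) ^ (α - 1))) x := by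
    intro x hx
    have h1 : HasDerivAt (fun u : ℝ => (1 + u) ^ α) (1 * α * (1 + x) ^ (α - 1)) x :=
      ((hasDerivAt_id' x).const_add 1).rpow_const (Or.inl (by linarith))
    have h2 : HasDerivAt (fun u : ℝ => 1 + α * u + α * (α - 1) * u ^ 2)
        (α * 1 + α * (α - 1) * (2 * x)) x := by
      have h3 := ((hasDerivAt_id' x).const_mul α).const_add 1
      have h4 : HasDerivAt (fun u : ℝ => u ^ 2) (2 * x) x := by simpa using hasDerivAt_pow 2 x
      exact h3.add (h4.const_mul _)
    exact (h2.sub h1).congr_deriv (by ring)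
  have h0 : φ 0 = 0 := by simp [hφ]
  suffices 0 ≤ φ u by
    simp only [hφ] at this
    linarith
  rcases le_total 0 u with h | h
  · have hm : MonotoneOn φ (Set.Icc 0 u) := by
      refine monotoneOn_of_deriv_nonneg (convex_Icc 0 u)
        (fun x hx => (hd x (by linarith [hx.1])).continuousAt.continuousWithinAt)
        (fun x hx => ?_) fun x hx => ?_
      all_goals rw [interior_Icc] at hx
      · exact (hd x (by linarith [hx.1])).differentiableAt.differentiableWithinAt
      · rw [(hd x (by linarith [hx.1])).deriv]
        refine mul_nonneg hα0.le (sub_nonneg.2 ?_)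
        set w := (α - 1) * x with hw
        have hw0 : 0 ≤ w := mul_nonneg hα1.le hx.1.le
        have hw1 : w ≤ 1 := (mul_le_mul_of_nonneg_left hx.2.le hα1.le).trans hu'
        have he := Real.abs_exp_sub_one_sub_id_le (x := w) (by rwa [abs_of_nonneg hw0])
        calc (1 + x) ^ (α - 1) ≤ Real.exp x ^ (α - 1) :=
              Real.rpow_le_rpow (by linarith [hx.1]) (by linarith [Real.add_one_le_exp x]) hα1.le
          _ = Real.exp w := by rw [← Real.exp_mul, hw, mul_comm]
          _ ≤ 1 + 2 * w := by nlinarith [(abs_le.1 he).2]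
    rw [← h0]
    exact hm ⟨le_rfl, h⟩ ⟨h, le_rfl⟩ h
  · have hm : AntitoneOn φ (Set.Icc u 0) := by
      refine antitoneOn_of_deriv_nonpos (convex_Icc u 0)
        (fun x hx => (hd x (by linarith [hx.1])).continuousAt.continuousWithinAt)
        (fun x hx => ?_) fun x hx => ?_
      all_goals rw [interior_Icc] at hx
      · exact (hd x (by linarith [hx.1])).differentiableAt.differentiableWithinAt
      · rw [(hd x (by linarith [hx.1])).deriv]
        refine mul_nonpos_of_nonneg_of_nonpos hα0.le (sub_nonpos.2 ?_)
        have hx1 : 0 < 1 + x := by linarith [hx.1]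
        have hl : 2 * x ≤ Real.log (1 + x) := by
          refine le_trans ?_ (Real.one_sub_inv_le_log_of_pos hx1)
          have : 1 - (1 + x)⁻¹ = x / (1 + x) := by field_simp; ring
          rw [this, le_div_iff₀ hx1]
          nlinarith [hx.1, hx.2]
        rw [Real.rpow_def_of_pos hx1]
        have := Real.add_one_le_exp (Real.log (1 + x) * (α - 1))
        nlinarith [mul_le_mul_of_nonneg_left hl hα1.le]
    rw [← h0]
    exact hm ⟨le_rfl, h⟩ ⟨h, le_rfl⟩ h

/-- The point at which `(α - 1) (sgmRatio - 1)` reaches `1`: left of it the quadratic bound applies,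
right of it an exponential one. -/
def tailPoint (q σ α : ℝ) : ℝ := σ ^ 2 * Real.log (1 + 1 / (q * (α - 1))) + 1 / 2

lemma gaussianRatio_eq_mul_exp {q σ α : ℝ} (hα : 1 < α) (hq : 0 < q) (hσ : 0 < σ) (z : ℝ) :
    gaussianRatio σ z =
      (1 + 1 / (q * (α - 1))) * Real.exp ((z - tailPoint q σ α) / σ ^ 2) := by
  have h1 : 0 < α - 1 := by linarith
  have : 0 < 1 + 1 / (q * (α - 1)) := by positivity
  conv_rhs => rw [← Real.exp_log this, ← Real.exp_add]
  rw [gaussianRatio, tailPoint]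
  congr 1
  field_simp
  ring

/-- Pointwise majorant of the integrand of the moment: a quadratic bound in the bulk plus an
exponential that takes over beyond `tailPoint`. Tilting the exponential by `tailPoint` itself gives
it the Gaussian integral `exp (-tailPoint² / (2 σ²))`. -/
lemma sgmRatio_rpow_le {q σ α : ℝ} (hα : 1 < α) (hq : 0 < q) (hq5 : q ≤ 1 / 5) (hσ : 0 < σ)
    (hαt : α ≤ tailPoint q σ α) (z : ℝ) :
    sgmRatio q σ z ^ α ≤ 1 + α * (q * (gaussianRatio σ z - 1)) +
      α * (α - 1) * (q * (gaussianRatio σ z - 1)) ^ 2 +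
      (α / (α - 1)) ^ α * Real.exp (tailPoint q σ α * (z - tailPoint q σ α) / σ ^ 2) := by
  have h1 : 0 < α - 1 := by linarith
  have h0 : 0 < α := by linarith
  have hr := gaussianRatio_eq_mul_exp hα hq hσ z
  have hr0 := gaussianRatio_pos σ z
  have hs := sgmRatio_pos ⟨hq, by linarith⟩ σ z
  set t := tailPoint q σ α
  set r := gaussianRatio σ z with hrdef
  have hq1 : q * (1 + 1 / (q * (α - 1))) = q + 1 / (α - 1) := by field_simp
  have hratio : 1 + 1 / (α - 1) = α / (α - 1) := by field_simp; ring
  rcases le_total z t with h | h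
  · have hE : Real.exp ((z - t) / σ ^ 2) ≤ 1 :=
      Real.exp_le_one_iff.2 (div_nonpos_of_nonpos_of_nonneg (by linarith) (by positivity))
    have hu : (α - 1) * (q * (r - 1)) ≤ 1 := by
      have : q * r ≤ q + 1 / (α - 1) := by
        rw [hr, ← mul_assoc, hq1]
        exact mul_le_of_le_one_right (by positivity) hE
      have h2 := mul_le_mul_of_nonneg_left this h1.le
      have h3 : (α - 1) * (q + 1 / (α - 1)) = (α - 1) * q + 1 := by field_simp
      rw [h3] at h2
      linarith
    have := one_add_rpow_le hα (u := q * (r - 1)) (by nlinarith) hu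
    have e : sgmRatio q σ z = 1 + q * (r - 1) := by rw [sgmRatio]; ring
    rw [e]
    exact this.trans (le_add_of_nonneg_right (by positivity))
  · have hE : 1 ≤ Real.exp ((z - t) / σ ^ 2) :=
      Real.one_le_exp (div_nonneg (by linarith) (by positivity))
    have hb : sgmRatio q σ z ≤ α / (α - 1) * Real.exp ((z - t) / σ ^ 2) := by
      rw [sgmRatio, ← hrdef, hr, ← mul_assoc, hq1, ← hratio]
      nlinarith
    have hr1 : 1 ≤ r := by
      rw [hr]
      exact one_le_mul_of_one_le_of_one_le (by simpa using (by positivity)) hE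
    have hu : 0 ≤ q * (r - 1) := mul_nonneg hq.le (by linarith)
    have hp : sgmRatio q σ z ^ α ≤ (α / (α - 1)) ^ α * Real.exp (t * (z - t) / σ ^ 2) := by
      refine (Real.rpow_le_rpow hs.le hb h0.le).trans ?_
      rw [Real.mul_rpow (by positivity) (by positivity), ← Real.exp_mul]
      gcongr
      rw [mul_comm, mul_div_assoc]
      exact mul_le_mul_of_nonneg_right hαt (div_nonneg (by linarith) (by positivity))
    have : 0 ≤ 1 + α * (q * (r - 1)) + α * (α - 1) * (q * (r - 1)) ^ 2 := by positivity
    linarith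

lemma integral_exp_mul_gaussian (σ t : ℝ) :
    ∫ z, Real.exp (t * z) ∂(gaussianReal 0 (σ ^ 2).toNNReal) = Real.exp (σ ^ 2 * t ^ 2 / 2) := by
  have h := congrFun (mgf_id_gaussianReal (μ := 0) (v := (σ ^ 2).toNNReal)) t
  simpa [mgf, Real.coe_toNNReal _ (sq_nonneg σ)] using h

/-- Integral of the majorant. -/
lemma renyiMoment_sgmMixture_le {q σ α : ℝ} (hα : 1 < α) (hq : 0 < q) (hq5 : q ≤ 1 / 5)
    (hσ : 0 < σ) (hαt : α ≤ tailPoint q σ α) :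
    renyiMoment α (sgmMixture q σ) (gaussianReal 0 (σ ^ 2).toNNReal) ≤
      ENNReal.ofReal (1 + α * (α - 1) * q ^ 2 * (Real.exp (1 / σ ^ 2) - 1) +
        (α / (α - 1)) ^ α * Real.exp (-(tailPoint q σ α ^ 2 / (2 * σ ^ 2)))) := by
  have hq' : 0 < q ∧ q ≤ 1 := ⟨hq, by linarith⟩
  rw [renyiMoment_sgmMixture hq' hσ]
  set t := tailPoint q σ α
  set N := gaussianReal 0 (σ ^ 2).toNNReal
  set c0 := 1 - α * q + α * (α - 1) * q ^ 2 with hc0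
  set c1 := (α * q - 2 * (α * (α - 1) * q ^ 2)) * Real.exp (-(1 / (2 * σ ^ 2))) with hc1
  set c2 := α * (α - 1) * q ^ 2 * Real.exp (-(1 / σ ^ 2)) with hc2
  set c3 := (α / (α - 1)) ^ α * Real.exp (-(t ^ 2 / σ ^ 2)) with hc3
  have hi : ∀ s : ℝ, Integrable (fun z : ℝ => Real.exp (s * z)) N :=
    integrable_exp_mul_gaussianReal
  have hpt : ∀ z, sgmRatio q σ z ^ α ≤ c0 + c1 * Real.exp (1 / σ ^ 2 * z) +
      c2 * Real.exp (2 / σ ^ 2 * z) + c3 * Real.exp (t / σ ^ 2 * z) := by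
    intro z
    refine (sgmRatio_rpow_le hα hq hq5 hσ hαt z).trans_eq ?_
    have e1 : gaussianRatio σ z = Real.exp (-(1 / (2 * σ ^ 2))) * Real.exp (1 / σ ^ 2 * z) := by
      rw [gaussianRatio, ← Real.exp_add]
      congr 1
      field_simp
      ring
    have e2 : gaussianRatio σ z ^ 2 = Real.exp (-(1 / σ ^ 2)) * Real.exp (2 / σ ^ 2 * z) := by
      rw [gaussianRatio, ← Real.exp_add, ← Real.exp_nat_mul]
      congr 1
      field_simp
      push_cast
      ring
    have e3 : Real.exp (t * (z - t) / σ ^ 2) =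
        Real.exp (-(t ^ 2 / σ ^ 2)) * Real.exp (t / σ ^ 2 * z) := by
      rw [← Real.exp_add]
      congr 1
      ring
    rw [e3, hc0, hc1, hc2, hc3]
    linear_combination (α * q - 2 * (α * (α - 1) * q ^ 2)) * e1 + α * (α - 1) * q ^ 2 * e2
  have i1 := (hi (1 / σ ^ 2)).const_mul c1
  have i2 := (hi (2 / σ ^ 2)).const_mul c2
  have i3 := (hi (t / σ ^ 2)).const_mul c3
  have i01 : Integrable (fun z => c0 + c1 * Real.exp (1 / σ ^ 2 * z)) N :=
    (integrable_const c0).add i1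
  have i012 : Integrable (fun z => c0 + c1 * Real.exp (1 / σ ^ 2 * z) +
      c2 * Real.exp (2 / σ ^ 2 * z)) N := i01.add i2
  refine (lintegral_mono fun z => ENNReal.ofReal_le_ofReal (hpt z)).trans_eq ?_
  refine (ofReal_integral_eq_lintegral_ofReal (i012.add i3) (ae_of_all _ fun z =>
    (Real.rpow_nonneg (sgmRatio_pos hq' σ z).le α).trans (hpt z))).symm.trans ?_
  congr 1
  have hint : ∫ z, (c0 + c1 * Real.exp (1 / σ ^ 2 * z) +
      c2 * Real.exp (2 / σ ^ 2 * z) + c3 * Real.exp (t / σ ^ 2 * z)) ∂N =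
      c0 + c1 * Real.exp (σ ^ 2 * (1 / σ ^ 2) ^ 2 / 2) +
        c2 * Real.exp (σ ^ 2 * (2 / σ ^ 2) ^ 2 / 2) +
        c3 * Real.exp (σ ^ 2 * (t / σ ^ 2) ^ 2 / 2) := by
    rw [integral_add i012 i3, integral_add i01 i2, integral_add (integrable_const _) i1,
      integral_const_mul, integral_const_mul, integral_const_mul, integral_exp_mul_gaussian,
      integral_exp_mul_gaussian, integral_exp_mul_gaussian]
    simp
  refine hint.trans ?_
  have f1 : Real.exp (-(1 / (2 * σ ^ 2))) * Real.exp (σ ^ 2 * (1 / σ ^ 2) ^ 2 / 2) = 1 := by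
    rw [← Real.exp_add, Real.exp_eq_one_iff]
    field_simp
    ring
  have f2 : Real.exp (-(1 / σ ^ 2)) * Real.exp (σ ^ 2 * (2 / σ ^ 2) ^ 2 / 2) =
      Real.exp (1 / σ ^ 2) := by
    rw [← Real.exp_add]
    congr 1
    field_simp
    ring
  have f3 : Real.exp (-(t ^ 2 / σ ^ 2)) * Real.exp (σ ^ 2 * (t / σ ^ 2) ^ 2 / 2) =
      Real.exp (-(t ^ 2 / (2 * σ ^ 2))) := by
    rw [← Real.exp_add]
    congr 1
    field_simp
    ring
  rw [hc0, hc1, hc2, hc3]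
  linear_combination (α * q - 2 * (α * (α - 1) * q ^ 2)) * f1 + α * (α - 1) * q ^ 2 * f2 +
    (α / (α - 1)) ^ α * f3

/-- What the regime is used for: with `L` the logarithm in its definition, the Gaussian decay at
`tailPoint` beats the loss in the exponential bound. For `L ≥ 1` this follows from `σ ≥ 4`; for
`L ≤ 1` the order `α` is at least `1 + 5 / (e - 1)`, and the last condition of the regime suffices.
The term `16 / 15` is `1`, from `(α / (α - 1))^(α - 1) ≤ e`, plus room for the factor `15 / 16` that
the tail is to have in `excess_le`. -/
lemma ClosedFormRegime.log_bound {q σ α : ℝ} (hq : 0 < q) (h : ClosedFormRegime q σ α) :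
    3 / 2 * Real.log (1 + 1 / (q * (α - 1))) + 16 / 15 + 2 * Real.log σ ≤
      σ ^ 2 * Real.log (1 + 1 / (q * (α - 1))) ^ 2 / 2 := by
  obtain ⟨hq5, hσ, hα, -, h2⟩ := h
  have h1 : 0 < α - 1 := by linarith
  set s := q * (α - 1) with hs
  have hs0 : 0 < s := by positivity
  set L := Real.log (1 + 1 / s) with hL
  have hpos : 0 < 1 + 1 / s := by positivity
  have hL0 : 0 < L := Real.log_pos (by simpa using (by positivity))
  rcases le_total 1 L with hL1 | hL1
  · have hlog : Real.log σ ≤ σ / 2 - 1 + Real.log 2 := by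
      have := Real.log_le_sub_one_of_pos (x := σ / 2) (by linarith)
      rw [Real.log_div (by linarith) two_ne_zero] at this
      linarith
    have hL2 : L ≤ L ^ 2 := by nlinarith
    have h3 : σ ^ 2 * L ≤ σ ^ 2 * L ^ 2 := mul_le_mul_of_nonneg_left hL2 (by positivity)
    have h4 : (σ ^ 2 / 2 - 3 / 2) * 1 ≤ (σ ^ 2 / 2 - 3 / 2) * L :=
      mul_le_mul_of_nonneg_left hL1 (by nlinarith)
    nlinarith [Real.log_two_lt_d9]
  · have hq0α : 0 < q * α := by positivity
    have hexpL : Real.exp L = 1 + 1 / s := Real.exp_log hpos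
    have hs58 : 29 / 50 ≤ s := by
      have : 1 + 1 / s ≤ 2.7182818286 := by
        rw [← hexpL]
        exact (Real.exp_le_exp.2 hL1).trans Real.exp_one_lt_d9.le
      have h5 : 1 / s ≤ 50 / 29 := by linarith [show (2.7182818286 : ℝ) - 1 ≤ 50 / 29 by norm_num]
      rw [div_le_iff₀ hs0] at h5
      linarith
    have hα39 : 39 / 10 ≤ α := by nlinarith
    have hD : 9 / 25 ≤ L + Real.log (q * α) := by
      rw [hL, ← Real.log_mul hpos.ne' hq0α.ne']
      have h6 : 1 + s ≤ (1 + 1 / s) * (q * α) := by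
        have : s ≤ q * α := by rw [hs]; nlinarith
        calc 1 + s = (1 + 1 / s) * s := by field_simp; ring
          _ ≤ _ := mul_le_mul_of_nonneg_left this hpos.le
      refine le_trans ?_ (Real.log_le_log (by positivity) h6)
      refine le_trans ?_ (Real.one_sub_inv_le_log_of_pos (by positivity))
      have : (1 + s)⁻¹ ≤ 16 / 25 := by
        rw [inv_le_comm₀ (by positivity) (by norm_num)]
        linarith [show ((16 : ℝ) / 25)⁻¹ ≤ 1 + 29 / 50 by norm_num]
      linarith
    have hσ2 : 0 < 1 / (2 * σ ^ 2) := by positivity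
    have hden : 0 < L + Real.log (q * α) + 1 / (2 * σ ^ 2) := by linarith
    rw [le_div_iff₀ hden] at h2
    have h7 : 39 / 10 * (9 / 25) ≤ α * (L + Real.log (q * α) + 1 / (2 * σ ^ 2)) :=
      mul_le_mul hα39 (by linarith) (by norm_num) (by linarith)
    have hlog5 : 1.386 ≤ Real.log 5 := by
      have : Real.log 4 = 2 * Real.log 2 := by
        rw [show (4 : ℝ) = 2 ^ 2 by norm_num, Real.log_pow]
        norm_num
      have h8 : Real.log 4 ≤ Real.log 5 := Real.log_le_log (by norm_num) (by norm_num)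
      linarith [Real.log_two_gt_d9]
    norm_num at hlog5
    linarith

lemma ClosedFormRegime.le_tailPoint {q σ α : ℝ} (hq : 0 < q) (h : ClosedFormRegime q σ α) :
    α ≤ tailPoint q σ α := by
  obtain ⟨-, hσ, hα, h1, -⟩ := h
  have : 0 < α - 1 := by linarith
  have hL0 : 0 < Real.log (1 + 1 / (q * (α - 1))) := Real.log_pos (by simpa using (by positivity))
  have hlog : 0 ≤ Real.log σ := Real.log_nonneg (by linarith)
  have : 0 ≤ σ ^ 2 * Real.log (1 + 1 / (q * (α - 1))) := by positivity
  unfold tailPoint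
  linarith

/-- In the regime, the excess of the moment over `1` is at most `2 α (α - 1) q² / σ²`: the quadratic
term contributes at most `17/16` of `α (α - 1) q² / σ²` and the tail at most `15/16` of it. -/
lemma ClosedFormRegime.excess_le {q σ α : ℝ} (hq : 0 < q) (h : ClosedFormRegime q σ α) :
    α * (α - 1) * q ^ 2 * (Real.exp (1 / σ ^ 2) - 1) +
        (α / (α - 1)) ^ α * Real.exp (-(tailPoint q σ α ^ 2 / (2 * σ ^ 2))) ≤
      (α - 1) * (2 * q ^ 2 * α / σ ^ 2) := by
  have hb := h.log_bound hq
  obtain ⟨-, hσ, hα, -, -⟩ := h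
  have h1 : 0 < α - 1 := by linarith
  have h0 : 0 < α := by linarith
  have hσ0 : 0 < σ := by linarith
  set s := q * (α - 1) with hs
  have hs0 : 0 < s := by positivity
  set L := Real.log (1 + 1 / s) with hL
  have hpos : 0 < 1 + 1 / s := by positivity
  have hL0 : 0 < L := Real.log_pos (by simpa using (by positivity))
  have hexpL : Real.exp L = 1 + 1 / s := Real.exp_log hpos
  have hbulk : Real.exp (1 / σ ^ 2) - 1 ≤ 17 / 16 * (1 / σ ^ 2) := by
    have hx : 1 / σ ^ 2 ≤ 1 / 16 := by
      rw [div_le_div_iff₀ (by positivity) (by norm_num)]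
      nlinarith
    have hx0 : 0 < 1 / σ ^ 2 := by positivity
    have he := Real.abs_exp_sub_one_sub_id_le (x := 1 / σ ^ 2)
      (by rw [abs_of_pos hx0]; linarith)
    nlinarith [(abs_le.1 he).2]
  have htail : (α / (α - 1)) ^ α * Real.exp (-(tailPoint q σ α ^ 2 / (2 * σ ^ 2))) ≤
      15 / 16 * (α * (α - 1) * q ^ 2 * (1 / σ ^ 2)) := by
    have hA : (α / (α - 1)) ^ α ≤ α / (α - 1) * Real.exp 1 := by
      have hp : 0 < α / (α - 1) := by positivity
      have e : (α / (α - 1)) ^ α = α / (α - 1) * (α / (α - 1)) ^ (α - 1) := by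
        rw [Real.rpow_sub_one hp.ne']
        field_simp
      rw [e]
      gcongr
      have : α / (α - 1) ≤ Real.exp (1 / (α - 1)) := by
        refine le_trans (le_of_eq ?_) (Real.add_one_le_exp _)
        field_simp
        ring
      refine (Real.rpow_le_rpow hp.le this h1.le).trans_eq ?_
      rw [← Real.exp_mul]
      congr 1
      field_simp
    have hE : Real.exp 1 * Real.exp (-(tailPoint q σ α ^ 2 / (2 * σ ^ 2))) ≤
        15 / 16 * (Real.exp (-L) ^ 2 * (1 / σ ^ 2)) := by
      have e1 : tailPoint q σ α ^ 2 / (2 * σ ^ 2) =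
          σ ^ 2 * L ^ 2 / 2 + L / 2 + 1 / (8 * σ ^ 2) := by
        rw [tailPoint, ← hs, ← hL]
        field_simp
        ring
      have e2 : Real.exp (-(1 / 15)) ≤ 15 / 16 := by
        rw [Real.exp_neg, inv_le_comm₀ (Real.exp_pos _) (by norm_num)]
        linarith [Real.add_one_le_exp (1 / 15 : ℝ), show ((15 : ℝ) / 16)⁻¹ = 1 / 15 + 1 by norm_num]
      have e3 : 1 / σ ^ 2 = Real.exp (-(2 * Real.log σ)) := by
        rw [Real.exp_neg, mul_comm, ← Real.rpow_def_of_pos hσ0]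
        simp
      calc Real.exp 1 * Real.exp (-(tailPoint q σ α ^ 2 / (2 * σ ^ 2)))
          ≤ Real.exp (-(1 / 15)) * (Real.exp (-L) ^ 2 * Real.exp (-(2 * Real.log σ))) := by
            rw [← Real.exp_nat_mul, ← Real.exp_add, ← Real.exp_add, ← Real.exp_add, e1]
            refine Real.exp_le_exp.2 ?_
            have : 0 < 1 / (8 * σ ^ 2) := by positivity
            push_cast
            linarith
        _ ≤ _ := by rw [← e3]; gcongr
    have hLs : Real.exp (-L) ≤ s := by
      rw [Real.exp_neg, hexpL, inv_le_iff_one_le_mul₀ hpos]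
      have : s * (1 + 1 / s) = s + 1 := by field_simp
      linarith
    calc (α / (α - 1)) ^ α * Real.exp (-(tailPoint q σ α ^ 2 / (2 * σ ^ 2)))
        ≤ α / (α - 1) * Real.exp 1 * Real.exp (-(tailPoint q σ α ^ 2 / (2 * σ ^ 2))) := by gcongr
      _ = α / (α - 1) * (Real.exp 1 * Real.exp (-(tailPoint q σ α ^ 2 / (2 * σ ^ 2)))) := by ring
      _ ≤ α / (α - 1) * (15 / 16 * (s ^ 2 * (1 / σ ^ 2))) := by
          refine mul_le_mul_of_nonneg_left (hE.trans ?_) (by positivity)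
          gcongr
      _ = _ := by
          rw [hs]
          field_simp
  have hc : 0 ≤ α * (α - 1) * q ^ 2 := by positivity
  have e : (α - 1) * (2 * q ^ 2 * α / σ ^ 2) =
      17 / 16 * (α * (α - 1) * q ^ 2 * (1 / σ ^ 2)) +
        15 / 16 * (α * (α - 1) * q ^ 2 * (1 / σ ^ 2)) := by ring
  rw [e]
  refine add_le_add ?_ htail
  linarith [mul_le_mul_of_nonneg_left hbulk hc]

lemma sgmRenyi_le_of_closedFormRegime {q σ α : ℝ} (hq : 0 < q) (h : ClosedFormRegime q σ α) :
    sgmRenyi q σ α ≤ ((2 * q ^ 2 * α / σ ^ 2 : ℝ) : EReal) := by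
  have hα : 1 < α := h.2.2.1
  have hσ : 0 < σ := by linarith [h.2.1]
  have hq' : 0 < q ∧ q ≤ 1 := ⟨hq, by linarith [h.1]⟩
  have hm : renyiMoment α (sgmMixture q σ) (gaussianReal 0 (σ ^ 2).toNNReal) ≤
      ENNReal.ofReal (Real.exp ((α - 1) * (2 * q ^ 2 * α / σ ^ 2))) := by
    refine (renyiMoment_sgmMixture_le hα hq h.1 hσ (h.le_tailPoint hq)).trans
      (ENNReal.ofReal_le_ofReal ?_)
    have h1 := h.excess_le hq
    have h2 := Real.add_one_le_exp ((α - 1) * (2 * q ^ 2 * α / σ ^ 2))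
    linarith
  rw [sgmRenyi, max_le_iff, renyiDiv_le_iff hα, renyiDiv_le_iff hα]
  refine ⟨⟨?_, hm⟩, ⟨?_, (renyiMoment_gaussianReal_sgmMixture_le hα hq' hσ).trans hm⟩⟩
  · rw [sgmMixture_eq_withDensity hq' hσ]
    exact withDensity_absolutelyContinuous _ _
  · conv_lhs => rw [gaussianReal_eq_withDensity_sgmMixture hq' hσ]
    exact withDensity_absolutelyContinuous _ _

lemma IsStepCost.sgmRenyi_le {q σ α ρ : ℝ} (hq : 0 < q) (h : IsStepCost q σ α ρ) :
    sgmRenyi q σ α ≤ (ρ : EReal) := by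
  rcases h with h | ⟨h, hρ⟩
  · exact h
  · exact (sgmRenyi_le_of_closedFormRegime hq h).trans (EReal.coe_le_coe_iff.2 hρ)

end IDPSGD

end

/-! ### Privacy of the mechanism -/

/-- Individualized privacy of DP-SGD with per-group Poisson sampling rates `q p` and one shared
noise multiplier `σ`, trained for `I` iterations: the per-step Rényi costs add up over the
iterations, and if each group's total cost converts to at most its budget `ε p` at some order, then
the released model satisfies `({ε_1, …, ε_P}, δ)`-DP. -/
theorem mainTheorem1 {X : Type*} [DecidableEq X] {P d : ℕ} (grp : X → Fin P)
    (loss : EuclideanSpace ℝ (Fin d) → X → ℝ)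
    (init : MeasureTheory.Measure (EuclideanSpace ℝ (Fin d)))
    [MeasureTheory.IsProbabilityMeasure init]
    (η B c σ : ℝ) (hB : 0 < B) (hc : 0 < c) (hσ : 0 < σ)
    (q : Fin P → ℝ) (hq : ∀ p, 0 < q p ∧ q p ≤ 1) (I : ℕ) :
    (∀ (p : Fin P) (α ρ : ℝ), 1 < α → IDPSGD.IsStepCost (q p) σ α ρ →
      IDPSGD.IsGroupRDP (IDPSGD.sampleMechanism grp loss init η B c σ q I) grp p α (I * ρ)) ∧
    (∀ (ε : Fin P → ℝ) (δ : ℝ), 0 < δ → δ < 1 →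
      (∀ p : Fin P, ∃ α ρ : ℝ, 1 < α ∧ IDPSGD.IsStepCost (q p) σ α ρ ∧
        IDPSGD.rdpToDP α (I * ρ) δ ≤ ε p) →
      IDPSGD.IsIDP (IDPSGD.sampleMechanism grp loss init η B c σ q I) grp ε δ) := by
  have hq' : ∀ p, 0 ≤ q p ∧ q p ≤ 1 := fun p => ⟨(hq p).1.le, (hq p).2⟩
  have hRDP : ∀ (p : Fin P) (α ρ : ℝ), 1 < α → IDPSGD.IsStepCost (q p) σ α ρ →
      IDPSGD.IsGroupRDP (IDPSGD.sampleMechanism grp loss init η B c σ q I) grp p α (I * ρ) := by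
    rintro p α ρ hα hρ D x hx rfl
    exact IDPSGD.renyiDiv_sampleMechanism_le grp loss init η B hc σ hq' hx hα
      (hρ.sgmRenyi_le (hq _).1) I
  refine ⟨hRDP, fun ε δ hδ _ h p D x hx hp R _ => ?_⟩
  obtain ⟨α, ρ, hα, hρ, hε⟩ := h p
  obtain ⟨h1, h2⟩ := hRDP p α ρ hα hρ D x hx hp
  rw [IDPSGD.renyiDiv_le_iff hα] at h1 h2
  have hM := IDPSGD.isProbabilityMeasure_sampleMechanism grp loss init η B c σ hq' I
  have := hM D
  have := hM (insert x D)
  exact ⟨IDPSGD.measure_le_of_renyiMoment_le hα hδ h1.1 h1.2 hε R,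
    IDPSGD.measure_le_of_renyiMoment_le hα hδ h2.1 h2.2 hε R⟩
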